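/- **Notation.** For $k\ge 1$ and $d\in\{2,3\}$ let $P_k(\mathbb{R}^d)$ be the real polynomials in $d$ variables of total degree at most $k$, let $\mathcal{H}_m(\mathbb{R}^d)$ be the homogeneous harmonic polynomials of degree $m$ (together with $0$), and let $$\mathcal{P}_{k,d}:=[P_k(\mathbb{R}^d)]^d+\nabla\mathcal{H}_{k+2}(\mathbb{R}^d)+\cdots+\nabla\mathcal{H}_{2k}(\mathbb{R}^d),$$ a space of polynomial vector fields on $\mathbb{R}^d$ (for $k=1$ there are no gradient terms). Fix a basis $e_1,\dots,e_d$ of $\mathbb{R}^d$. Let $T\subset\mathbb{R}^d$ be a nondegenerate closed triangle ($d=2$) or tetrahedron ($d=3$), with barycentric coordinates $\lambda_0,\dots,\lambda_d$ and edges (resp. faces) $F_j=\{z\in T:\lambda_j(z)=0\}$, $0\le j\le d$. Let $\mathcal{N}_{k,d}(T)$ be the family that consists of the functionals $$M_{i,\alpha}(v)=\int_T\lambda_0^{\alpha_0}\cdots\lambda_d^{\alpha_d}\,(v\cdot e_i)\,dx,\qquad 1\le i\le d,\ \alpha\in\mathbb{Z}_{\ge0}^{d+1},\ \alpha_0+\cdots+\alpha_d=k-2,$$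 (none if $k=1$) and $$M_{i,j,\beta}(v)=\int_{F_j}\lambda_0^{\beta_0}\cdots\lambda_d^{\beta_d}\,(v\cdot e_i)\,ds,\qquad 1\le i\le d,\ 0\le j\le d,\ \beta\in\mathbb{Z}_{\ge0}^{d+1},\ \beta_0+\cdots+\beta_d=k-1,\ \beta_j=0,$$ where $ds$ is arc length (resp. surface area) and $0^0=1$. Denote by $\mathrm{Conj}(k,d)$ the assertion that, for every such $T$, the elements of $\mathcal{P}_{k,d}$ are uniquely determined by the functionals in $\mathcal{N}_{k,d}(T)$: for every family of real numbers indexed by the above functionals there is exactly one $v\in\mathcal{P}_{k,d}$ on which the functionals take these values. **Theorem.** Whatever the basis $e_1,\dots,e_d$: 1. $\mathrm{Conj}(k,2)$ holds for every $k\ge 1$ (in particular for every $k\ge 3$). 2. $\mathrm{Conj}(2,3)$ is false. More precisely, let $T_0$ be the tetrahedron with vertices $(0,0,0),(1,0,0),(0,1,0),(0,0,1)$ and let $$\begin{aligned}P_0={}&3x+10x^3-15x^4+3y-18xy-15x^2y+30x^3y-15xy^2+45x^2y^2+10y^3\\&+30xy^3-15y^4+3z-18xz-15x^2z+30x^3z-18yz+240xyz-180x^2yz\\&-15y^2z-180xy^2z+30y^3z-15xz^2+45x^2z^2-15yz^2-180xyz^2+45y^2z^2\\&+10z^3+30xz^3+30yz^3-15z^4.\end{aligned}$$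 Then $P_0$ is a harmonic polynomial of degree $4$, its gradient $u_0=\nabla P_0$ belongs to $\mathcal{P}_{2,3}$, $u_0\ne 0$, and every functional in $\mathcal{N}_{2,3}(T_0)$ vanishes on $u_0$. -/

import Mathlib

open MeasureTheory

noncomputable section

namespace NonconformingFE

/-- `ℝ^d` with its Euclidean norm, inner product and Lebesgue measure. -/
abbrev Space (d : ℕ) : Type := EuclideanSpace ℝ (Fin d)

/-- Polynomial vector fields on `ℝ^d`, given by their `d` Cartesian components. -/
abbrev VField (d : ℕ) : Type := Fin d → MvPolynomial (Fin d) ℝ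

/-- The value in `ℝ^d` of the polynomial vector field `v` at the point `x`. -/
def VField.value {d : ℕ} (v : VField d) (x : Space d) : Space d :=
  WithLp.toLp 2 fun i => MvPolynomial.eval (fun j => x j) (v i)

/-- The gradient, as a linear map from polynomials to polynomial vector fields. -/
def polyGradient (d : ℕ) : MvPolynomial (Fin d) ℝ →ₗ[ℝ] VField d :=
  LinearMap.pi fun i => (MvPolynomial.pderiv i).toLinearMap

/-- The Laplacian on polynomials in `d` variables. -/
def laplacian (d : ℕ) : MvPolynomial (Fin d) ℝ →ₗ[ℝ] MvPolynomial (Fin d) ℝ :=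
  ∑ i : Fin d, (MvPolynomial.pderiv i).toLinearMap ∘ₗ (MvPolynomial.pderiv i).toLinearMap

/-- `H_m(ℝ^d)`: the homogeneous harmonic polynomials of degree `m` in `d` variables
(together with `0`). -/
def harmonicHomogeneous (d m : ℕ) : Submodule ℝ (MvPolynomial (Fin d) ℝ) :=
  MvPolynomial.homogeneousSubmodule (Fin d) ℝ m ⊓ LinearMap.ker (laplacian d)

/-- `[P_k(ℝ^d)]^d`: vector fields whose components have total degree at most `k`. -/
def polyFields (k d : ℕ) : Submodule ℝ (VField d) :=
  Submodule.pi Set.univ fun _ => MvPolynomial.restrictTotalDegree (Fin d) ℝ k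

/-- `P_{k,d} = [P_k(ℝ^d)]^d ⊕ ∇H_{k+2}(ℝ^d) ⊕ ⋯ ⊕ ∇H_{2k}(ℝ^d)`. -/
def fieldSpace (k d : ℕ) : Submodule ℝ (VField d) :=
  polyFields k d ⊔ ⨆ m ∈ Finset.Icc (k + 2) (2 * k), (harmonicHomogeneous d m).map (polyGradient d)

/-- A nondegenerate `d`-simplex in `ℝ^d` (a triangle for `d = 2`, a tetrahedron for `d = 3`),
given by its affinely independent vertices `T 0, …, T d`. Its barycentric coordinates
are `T.coord 0, …, T.coord d`. -/
abbrev Simplex (d : ℕ) : Type := AffineBasis (Fin (d + 1)) ℝ (Space d)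

/-- The closed simplex as a set of points. -/
def Simplex.body {d : ℕ} (T : Simplex d) : Set (Space d) :=
  convexHull ℝ (Set.range T)

/-- The facet `F_j = {z ∈ T : λ_j(z) = 0}` (an edge for `d = 2`, a face for `d = 3`). -/
def Simplex.facet {d : ℕ} (T : Simplex d) (j : Fin (d + 1)) : Set (Space d) :=
  {z ∈ Simplex.body T | T.coord j z = 0}

/-- The monomial `λ_0^{α_0} ⋯ λ_d^{α_d}` in the barycentric coordinates (with `0^0 = 1`). -/
def Simplex.baryMonomial {d : ℕ} (T : Simplex d) (α : Fin (d + 1) → ℕ) (x : Space d) : ℝ :=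
  ∏ l, T.coord l x ^ α l

/-- Indices `(i, α)` of the moments on the simplex: `α_0 + ⋯ + α_d = k - 2`
(so there are none for `k = 1`). -/
abbrev InteriorIndex (k d : ℕ) : Type :=
  Fin d × {α : Fin (d + 1) → ℕ // ∑ l, α l + 2 = k}

/-- Indices `(i, j, β)` of the moments on the facets: `β_0 + ⋯ + β_d = k - 1` and `β_j = 0`. -/
abbrev FacetIndex (k d : ℕ) : Type :=
  Fin d × (Σ j : Fin (d + 1), {β : Fin (d + 1) → ℕ // ∑ l, β l + 1 = k ∧ β j = 0})

/-- The functionals `N_{k,d}(T)`, relative to a fixed basis `e` of `ℝ^d`: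
`M_{i,α}(v) = ∫_T λ^α (v · e_i)` with respect to Lebesgue measure, and
`M_{i,j,β}(v) = ∫_{F_j} λ^β (v · e_i)` with respect to the `(d-1)`-dimensional Euclidean
surface measure (arc length for `d = 2`, area for `d = 3`). -/
def moment {k d : ℕ} (T : Simplex d) (e : Module.Basis (Fin d) ℝ (Space d)) :
    InteriorIndex k d ⊕ FacetIndex k d → VField d → ℝ
  | Sum.inl (i, α), v =>
      ∫ x in Simplex.body T, Simplex.baryMonomial T α.1 x * inner ℝ (VField.value v x) (e i)
  | Sum.inr (i, ⟨j, β⟩), v =>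
      ∫ x in Simplex.facet T j,
        Simplex.baryMonomial T β.1 x * inner ℝ (VField.value v x) (e i) ∂μHE[d - 1]

/-- `Conj(k,d)`, relative to a fixed basis `e` of `ℝ^d`: for every simplex `T`, the elements of
`P_{k,d}` are uniquely determined by the functionals in `N_{k,d}(T)` (unisolvence), that is,
for every prescription of the values of these functionals there is exactly one
element of `P_{k,d}` which attains them. -/
def Conj (k d : ℕ) (e : Module.Basis (Fin d) ℝ (Space d)) : Prop :=
  ∀ T : Simplex d, Function.Bijective
    fun (v : fieldSpace k d) (ι : InteriorIndex k d ⊕ FacetIndex k d) => moment T e ι v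

/-- The vertices of the unit tetrahedron are affinely independent. -/
theorem unitTetrahedron_aux :
    AffineIndependent ℝ (Fin.cons 0 fun i : Fin 3 => EuclideanSpace.single i (1 : ℝ) :
      Fin 4 → Space 3) := by
  rw [affineIndependent_iff_linearIndependent_vsub ℝ _ (0 : Fin 4)]
  have h := (EuclideanSpace.basisFun (Fin 3) ℝ).toBasis.linearIndependent
  have h2 := h.comp (fun x : {x : Fin 4 // x ≠ 0} => x.1.pred x.2)
    (fun a b hab => Subtype.ext (Fin.pred_inj.1 hab))
  have h3 : (fun x : {x : Fin 4 // x ≠ 0} =>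
      (Fin.cons 0 fun i : Fin 3 => EuclideanSpace.single i (1 : ℝ) : Fin 4 → Space 3) x -ᵥ
        (Fin.cons 0 fun i : Fin 3 => EuclideanSpace.single i (1 : ℝ) : Fin 4 → Space 3) 0) =
      (EuclideanSpace.basisFun (Fin 3) ℝ).toBasis ∘
        fun x : {x : Fin 4 // x ≠ 0} => x.1.pred x.2 := by
    funext ⟨x, hx⟩
    obtain ⟨y, rfl⟩ := Fin.exists_succ_eq.2 hx
    simp
  rw [h3]
  exact h2

/-- The tetrahedron with vertices `(0,0,0)`, `(1,0,0)`, `(0,1,0)`, `(0,0,1)`. -/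
def unitTetrahedron : Simplex 3 where
  toFun := Fin.cons 0 fun i : Fin 3 => EuclideanSpace.single i (1 : ℝ)
  ind' := unitTetrahedron_aux
  tot' := unitTetrahedron_aux.affineSpan_eq_top_iff_card_eq_finrank_add_one.2 (by simp)

/-- The polynomial `P_0` in the variables `x, y, z`. -/
def counterPoly : MvPolynomial (Fin 3) ℝ :=
  let x : MvPolynomial (Fin 3) ℝ := MvPolynomial.X 0
  let y : MvPolynomial (Fin 3) ℝ := MvPolynomial.X 1
  let z : MvPolynomial (Fin 3) ℝ := MvPolynomial.X 2
  3 * x + 10 * x ^ 3 - 15 * x ^ 4 + 3 * y - 18 * x * y - 15 * x ^ 2 * y + 30 * x ^ 3 * y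
    - 15 * x * y ^ 2 + 45 * x ^ 2 * y ^ 2 + 10 * y ^ 3
    + 30 * x * y ^ 3 - 15 * y ^ 4 + 3 * z - 18 * x * z - 15 * x ^ 2 * z + 30 * x ^ 3 * z
    - 18 * y * z + 240 * x * y * z - 180 * x ^ 2 * y * z
    - 15 * y ^ 2 * z - 180 * x * y ^ 2 * z + 30 * y ^ 3 * z - 15 * x * z ^ 2
    + 45 * x ^ 2 * z ^ 2 - 15 * y * z ^ 2 - 180 * x * y * z ^ 2 + 45 * y ^ 2 * z ^ 2
    + 10 * z ^ 3 + 30 * x * z ^ 3 + 30 * y * z ^ 3 - 15 * z ^ 4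

end NonconformingFE

end

/-! Dimension two. Let all functionals vanish on `v`. Integrating a derivative over the triangle by
parts shows that `div v` and `curl v` are orthogonal to all polynomials of degree at most `k - 1`:
the boundary terms are edge moments, the remaining term is an interior moment. Gradients of harmonic
polynomials have neither divergence nor curl, so `div v` and `curl v` come from the part of `v` in
`[P_k]^2`; they have degree at most `k - 1`, and testing them against themselves gives zero
(`VanishingMoments.pderiv_combination_eq_zero`).

Hence `v_0 - i v_1` is a polynomial `Q` in `z = x + i y`, of degree below `2k`, and the edge moments
say that `Q` is orthogonal to `z^j`, `j < k`, along each edge. Take antiderivatives `k` times,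
always vanishing at the vertex `a`. Along each edge issuing from `a`, the zeroth moment makes the
antiderivative vanish at the other end, and an integration by parts passes the lower moments on to
it. The result `R` has degree below `3k` and a zero of order `k` at each of the three vertices, so
`R = 0` and `Q = 0` (`eq_zero_of_segmentIntegral_eq_zero`). Existence follows by counting
dimensions: the space is at least as large as the set of functionals.

Dimension three. `counterPoly` is the sum of a harmonic polynomial of degree at most three and a
homogeneous harmonic quartic, so its gradient lies in the space. It is symmetric in the variables,
so a single partial derivative has to be tested: against constants on the tetrahedron and against
affine weights on the slanted face, on the coordinate face orthogonal to the derivative and on one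
of the other two. These are explicit integrals over reference simplices.

On both sides, Hausdorff measure on facets is handled only up to a constant factor: uniqueness of
Haar measure makes it a multiple of the push-forward of Lebesgue measure under an affine
parametrization. -/

namespace NonconformingFE

open Module Measure
open scoped NNReal

/-! ### Hausdorff measure on affine subspaces. -/

section AffineParametrization

variable {E V : Type*} [NormedAddCommGroup E] [NormedSpace ℝ E] [FiniteDimensional ℝ E]
  [MeasurableSpace E] [BorelSpace E] [NormedAddCommGroup V] [NormedSpace ℝ V]
  [MeasurableSpace V] [BorelSpace V]

/-- An injective affine map transports Haar measure to a nonzero multiple of the Hausdorff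
measure on its range. -/
theorem exists_restrict_eq_smul_map (μ : Measure E) [μ.IsAddHaarMeasure] (φ : E →ᵃ[ℝ] V)
    (hφ : Function.Injective φ) :
    ∃ c : ℝ≥0, c ≠ 0 ∧ ∀ F ⊆ Set.range φ, MeasurableSet F →
      (μHE[finrank ℝ E] : Measure V).restrict F = c • (μ.restrict (φ ⁻¹' F)).map φ := by
  have hlin : Function.Injective φ.linear := (AffineMap.linear_injective_iff φ).2 hφ
  let R := LinearMap.range φ.linear
  let eq : E ≃L[ℝ] R := (LinearEquiv.ofInjective φ.linear hlin).toContinuousLinearEquiv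
  have hfr : finrank ℝ E = finrank ℝ R := (LinearEquiv.ofInjective φ.linear hlin).finrank_eq
  have : (μ.map eq).IsAddHaarMeasure := eq.isAddHaarMeasure_map μ
  have hφc : Continuous φ := φ.continuous_of_finiteDimensional
  let ι : R → V := fun r => r.1 + φ 0
  have hι : Isometry ι := (isometry_add_right (φ 0)).comp isometry_subtype_coe
  have hcomp : ι ∘ eq = φ := by
    funext x
    have := congrFun (AffineMap.decomp φ) x
    simp only [Pi.add_apply] at this
    rw [this]
    rfl
  have hrange : Set.range φ = Set.range ι := by
    rw [← hcomp, Set.range_comp, eq.surjective.range_eq, Set.image_univ]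
  refine ⟨addHaarScalarFactor (μHE[finrank ℝ R] : Measure R) (μ.map eq),
    (addHaarScalarFactor_pos_of_isAddHaarMeasure _ _).ne', fun F hF hFm => ?_⟩
  -- `φ` factors as the linear isomorphism `eq` onto `R` followed by the isometry `ι`. The isometry
  -- preserves Hausdorff measure, and on `R` Hausdorff measure and the image of `μ` are both Haar
  -- measures, hence proportional.
  have key : (μHE[finrank ℝ E] : Measure V).restrict (Set.range φ) =
      addHaarScalarFactor (μHE[finrank ℝ R] : Measure R) (μ.map eq) • μ.map φ := by
    rw [hrange, hfr, ← hι.map_euclideanHausdorffMeasure]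
    conv_lhs => rw [isAddLeftInvariant_eq_smul (μHE[finrank ℝ R] : Measure R) (μ.map eq)]
    rw [Measure.map_smul, Measure.map_map hι.continuous.measurable eq.continuous.measurable, hcomp]
  rw [← Measure.restrict_restrict_of_subset hF, key, Measure.restrict_smul,
    Measure.restrict_map hφc.measurable hFm]

end AffineParametrization

/-! ### Affine parametrizations of triangles, tetrahedra and their facets. -/

namespace Simplex

variable {d : ℕ} (T : Simplex d)

theorem mem_body {z : Space d} : z ∈ T.body ↔ ∀ l, 0 ≤ T.coord l z := by
  rw [Simplex.body, AffineBasis.convexHull_eq_nonneg_coord]; rfl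

theorem mem_facet {j : Fin (d + 1)} {z : Space d} :
    z ∈ T.facet j ↔ (∀ l, 0 ≤ T.coord l z) ∧ T.coord j z = 0 := by
  rw [Simplex.facet, Set.mem_ofPred_eq, mem_body]

theorem isCompact_body : IsCompact T.body := (Set.finite_range T).isCompact_convexHull ℝ

theorem continuous_coord (l : Fin (d + 1)) : Continuous (T.coord l) :=
  (T.coord l).continuous_of_finiteDimensional

theorem isClosed_facet (j : Fin (d + 1)) : IsClosed (T.facet j) :=
  T.isCompact_body.isClosed.inter (isClosed_eq (T.continuous_coord j) continuous_const)

theorem isCompact_facet (j : Fin (d + 1)) : IsCompact (T.facet j) :=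
  T.isCompact_body.of_isClosed_subset (T.isClosed_facet j) fun _ h => h.1

theorem eq_of_coord_eq {x y : Space d} (h : ∀ l, T.coord l x = T.coord l y) : x = y :=
  T.ext_elem h

/-- The reference triangle. -/
def refTriangle : Set (ℝ × ℝ) := {x | 0 ≤ x.1 ∧ 0 ≤ x.2 ∧ x.1 + x.2 ≤ 1}

/-- The reference tetrahedron. -/
def refTetrahedron : Set ((ℝ × ℝ) × ℝ) := {x | x.1 ∈ refTriangle ∧ 0 ≤ x.2 ∧ x.2 ≤ 1 - x.1.1 - x.1.2}

/-- The affine parametrization of the line through two vertices. -/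
noncomputable def edgeMap (p q : Fin (d + 1)) : ℝ →ᵃ[ℝ] Space d := AffineMap.lineMap (T p) (T q)

/-- The affine parametrization of the plane through three vertices. -/
noncomputable def triMap (p q r : Fin (d + 1)) : ℝ × ℝ →ᵃ[ℝ] Space d :=
  ((LinearMap.fst ℝ ℝ ℝ).smulRight (T q - T p) +
    (LinearMap.snd ℝ ℝ ℝ).smulRight (T r - T p)).toAffineMap + AffineMap.const ℝ (ℝ × ℝ) (T p)

/-- The affine parametrization of the space through four vertices. -/
noncomputable def tetMap (p q r u : Fin (d + 1)) : (ℝ × ℝ) × ℝ →ᵃ[ℝ] Space d :=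
  (T.triMap p q r).comp (LinearMap.fst ℝ (ℝ × ℝ) ℝ).toAffineMap +
    ((LinearMap.snd ℝ (ℝ × ℝ) ℝ).smulRight (T u - T p)).toAffineMap

theorem edgeMap_apply (p q : Fin (d + 1)) (t : ℝ) :
    T.edgeMap p q t = T p + t • (T q - T p) := by
  simp [edgeMap, AffineMap.lineMap_apply, add_comm]

theorem triMap_apply (p q r : Fin (d + 1)) (x : ℝ × ℝ) :
    T.triMap p q r x = T p + x.1 • (T q - T p) + x.2 • (T r - T p) := by
  simp only [triMap, AffineMap.coe_add, LinearMap.coe_toAffineMap, AffineMap.coe_const,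
    Pi.add_apply, LinearMap.add_apply, LinearMap.smulRight_apply, LinearMap.fst_apply,
    LinearMap.snd_apply, Function.const_apply]
  abel

theorem tetMap_apply (p q r u : Fin (d + 1)) (x : (ℝ × ℝ) × ℝ) :
    T.tetMap p q r u x =
      T p + x.1.1 • (T q - T p) + x.1.2 • (T r - T p) + x.2 • (T u - T p) := by
  simp [tetMap, triMap_apply]

theorem affine_apply_add_smul_sub (f : Space d →ᵃ[ℝ] ℝ) (x y p : Space d) (s : ℝ) :
    f (x + s • (y - p)) = f x + s * (f y - f p) := by
  have h1 := f.map_vadd x (s • (y - p))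
  have h2 := f.linearMap_vsub y p
  simp only [vadd_eq_add, vsub_eq_sub, map_smul, smul_eq_mul] at h1 h2
  rw [add_comm, h1, h2, add_comm]

theorem coord_edgeMap (l p q : Fin (d + 1)) (t : ℝ) :
    T.coord l (T.edgeMap p q t) =
      T.coord l (T p) + t * (T.coord l (T q) - T.coord l (T p)) := by
  rw [edgeMap_apply, affine_apply_add_smul_sub]

theorem coord_triMap (l p q r : Fin (d + 1)) (x : ℝ × ℝ) :
    T.coord l (T.triMap p q r x) = T.coord l (T p) + x.1 * (T.coord l (T q) - T.coord l (T p)) +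
      x.2 * (T.coord l (T r) - T.coord l (T p)) := by
  rw [triMap_apply, affine_apply_add_smul_sub, affine_apply_add_smul_sub]

theorem coord_tetMap (l p q r u : Fin (d + 1)) (x : (ℝ × ℝ) × ℝ) :
    T.coord l (T.tetMap p q r u x) =
      T.coord l (T p) + x.1.1 * (T.coord l (T q) - T.coord l (T p)) +
      x.1.2 * (T.coord l (T r) - T.coord l (T p)) +
      x.2 * (T.coord l (T u) - T.coord l (T p)) := by
  rw [tetMap_apply, affine_apply_add_smul_sub, affine_apply_add_smul_sub,
    affine_apply_add_smul_sub]

theorem coord_vertex (l p : Fin (d + 1)) : T.coord l (T p) = if l = p then 1 else 0 :=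
  T.coord_apply l p

theorem edgeMap_injective {p q : Fin (d + 1)} (h : p ≠ q) :
    Function.Injective (T.edgeMap p q) := by
  intro x y hxy
  simpa [coord_edgeMap, coord_vertex, h.symm] using congrArg (T.coord q) hxy

theorem triMap_injective {p q r : Fin (d + 1)} (hpq : p ≠ q) (hpr : p ≠ r) (hqr : q ≠ r) :
    Function.Injective (T.triMap p q r) := by
  intro x y hxy
  have h1 := congrArg (T.coord q) hxy
  have h2 := congrArg (T.coord r) hxy
  simp [coord_triMap, hpq.symm, hqr, hqr.symm, hpr.symm] at h1 h2
  exact Prod.ext h1 h2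

theorem tetMap_injective {p q r u : Fin (d + 1)} (hpq : p ≠ q) (hpr : p ≠ r) (hqr : q ≠ r)
    (hpu : p ≠ u) (hqu : q ≠ u) (hru : r ≠ u) :
    Function.Injective (T.tetMap p q r u) := by
  intro x y hxy
  have h1 := congrArg (T.coord q) hxy
  have h2 := congrArg (T.coord r) hxy
  have h3 := congrArg (T.coord u) hxy
  simp [coord_tetMap, hpq.symm, hqr, hqr.symm, hpr.symm, hpu.symm, hqu, hru,
    hqu.symm, hru.symm] at h1 h2 h3
  exact Prod.ext (Prod.ext h1 h2) h3

theorem sum_coord (x : Space d) : ∑ l, T.coord l x = 1 := T.sum_coord_apply_eq_one x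

theorem univ_fin_three {p q r : Fin 3} (hpq : p ≠ q) (hpr : p ≠ r) (hqr : q ≠ r) :
    (Finset.univ : Finset (Fin 3)) = {p, q, r} := by decide +revert

theorem univ_fin_four {p q r u : Fin 4} (hpq : p ≠ q) (hpr : p ≠ r) (hqr : q ≠ r) (hpu : p ≠ u)
    (hqu : q ≠ u) (hru : r ≠ u) : (Finset.univ : Finset (Fin 4)) = {p, q, r, u} := by
  decide +revert

theorem coord_sum_three (T : Simplex 2) {p q r : Fin 3} (hpq : p ≠ q) (hpr : p ≠ r) (hqr : q ≠ r)
    (x : Space 2) : T.coord p x + T.coord q x + T.coord r x = 1 := by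
  have h := T.sum_coord x
  rwa [univ_fin_three hpq hpr hqr, Finset.sum_insert (by simp [hpq, hpr]),
    Finset.sum_insert (by simp [hqr]), Finset.sum_singleton, ← add_assoc] at h

theorem coord_sum_four (T : Simplex 3) {p q r u : Fin 4} (hpq : p ≠ q) (hpr : p ≠ r) (hqr : q ≠ r)
    (hpu : p ≠ u) (hqu : q ≠ u) (hru : r ≠ u) (x : Space 3) :
    T.coord p x + T.coord q x + T.coord r x + T.coord u x = 1 := by
  have h := T.sum_coord x
  rwa [univ_fin_four hpq hpr hqr hpu hqu hru, Finset.sum_insert (by simp [hpq, hpr, hpu]),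
    Finset.sum_insert (by simp [hqr, hqu]), Finset.sum_insert (by simp [hru]),
    Finset.sum_singleton, ← add_assoc, ← add_assoc] at h

theorem cover_three {p q r : Fin 3} (hpq : p ≠ q) (hpr : p ≠ r) (hqr : q ≠ r) (l : Fin 3) :
    l = p ∨ l = q ∨ l = r := by
  simpa [univ_fin_three hpq hpr hqr] using Finset.mem_univ l

theorem cover_four {p q r u : Fin 4} (hpq : p ≠ q) (hpr : p ≠ r) (hqr : q ≠ r) (hpu : p ≠ u)
    (hqu : q ≠ u) (hru : r ≠ u) (l : Fin 4) : l = p ∨ l = q ∨ l = r ∨ l = u := by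
  simpa [univ_fin_four hpq hpr hqr hpu hqu hru] using Finset.mem_univ l

/-- Arc length on an edge of a triangle. -/
theorem exists_restrict_facet_two (T : Simplex 2) {p q j : Fin 3} (hpq : p ≠ q)
    (hpj : p ≠ j) (hqj : q ≠ j) :
    ∃ c : ℝ≥0, c ≠ 0 ∧ (μHE[1] : Measure (Space 2)).restrict (T.facet j) =
      c • (volume.restrict (Set.Icc (0 : ℝ) 1)).map (T.edgeMap p q) := by
  obtain ⟨c, hc, h⟩ := exists_restrict_eq_smul_map (volume : Measure ℝ) (T.edgeMap p q)
    (T.edgeMap_injective hpq)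
  refine ⟨c, hc, ?_⟩
  rw [finrank_self] at h
  rw [h _ ?_ (T.isClosed_facet j).measurableSet]
  · congr 3
    ext t
    simp only [Set.mem_preimage, mem_facet, coord_edgeMap, coord_vertex, Set.mem_Icc]
    constructor
    · rintro ⟨h1, -⟩
      have a1 := h1 p
      have a2 := h1 q
      simp [hpq, hpq.symm] at a1 a2
      exact ⟨a2, a1⟩
    · rintro ⟨h1, h2⟩
      refine ⟨fun l => ?_, by simp [hpj.symm, hqj.symm]⟩
      rcases cover_three hpq hpj hqj l with rfl | rfl | rfl <;> simp [*, hpq.symm, Ne.symm]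
  · intro x hx
    rw [mem_facet] at hx
    have hs := T.coord_sum_three hpq hpj hqj x
    refine ⟨T.coord q x, T.eq_of_coord_eq fun l => ?_⟩
    rw [coord_edgeMap]
    simp only [coord_vertex]
    rcases cover_three hpq hpj hqj l with rfl | rfl | rfl <;> simp [*, hpq.symm, Ne.symm]
    linarith

/-- Lebesgue measure on a triangle. -/
theorem exists_restrict_body_two (T : Simplex 2) {p q r : Fin 3} (hpq : p ≠ q)
    (hpr : p ≠ r) (hqr : q ≠ r) :
    ∃ c : ℝ≥0, c ≠ 0 ∧ (volume : Measure (Space 2)).restrict T.body =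
      c • (volume.restrict refTriangle).map (T.triMap p q r) := by
  obtain ⟨c, hc, h⟩ := exists_restrict_eq_smul_map (volume : Measure (ℝ × ℝ)) (T.triMap p q r)
    (T.triMap_injective hpq hpr hqr)
  refine ⟨c, hc, ?_⟩
  rw [finrank_prod, finrank_self, EuclideanSpace.euclideanHausdorffMeasure_eq_volume] at h
  rw [h _ ?_ T.isCompact_body.measurableSet]
  · congr 3
    ext t
    simp only [Set.mem_preimage, mem_body, coord_triMap, coord_vertex, refTriangle,
      Set.mem_ofPred_eq]
    constructor
    · intro h1
      have a1 := h1 p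
      have a2 := h1 q
      have a3 := h1 r
      simp [hpq, hpq.symm, hpr, hpr.symm, hqr, hqr.symm] at a1 a2 a3
      exact ⟨a2, a3, by linarith⟩
    · rintro ⟨h1, h2, h3⟩ l
      rcases cover_three hpq hpr hqr l with rfl | rfl | rfl <;>
        simp [*, hpq.symm, hpr.symm, hqr.symm]
      linarith
  · intro x hx
    have hs := T.coord_sum_three hpq hpr hqr x
    refine ⟨(T.coord q x, T.coord r x), T.eq_of_coord_eq fun l => ?_⟩
    rw [coord_triMap]
    simp only [coord_vertex]
    rcases cover_three hpq hpr hqr l with rfl | rfl | rfl <;>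
      simp [*, hpq.symm, hpr.symm, hqr.symm]
    linarith

/-- Area measure on a face of a tetrahedron. -/
theorem exists_restrict_facet_three (T : Simplex 3) {p q r j : Fin 4} (hpq : p ≠ q)
    (hpr : p ≠ r) (hqr : q ≠ r) (hpj : p ≠ j) (hqj : q ≠ j) (hrj : r ≠ j) :
    ∃ c : ℝ≥0, c ≠ 0 ∧ (μHE[2] : Measure (Space 3)).restrict (T.facet j) =
      c • (volume.restrict refTriangle).map (T.triMap p q r) := by
  obtain ⟨c, hc, h⟩ := exists_restrict_eq_smul_map (volume : Measure (ℝ × ℝ)) (T.triMap p q r)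
    (T.triMap_injective hpq hpr hqr)
  refine ⟨c, hc, ?_⟩
  rw [finrank_prod, finrank_self] at h
  rw [h _ ?_ (T.isClosed_facet j).measurableSet]
  · congr 3
    ext t
    simp only [Set.mem_preimage, mem_facet, coord_triMap, coord_vertex, refTriangle,
      Set.mem_ofPred_eq]
    constructor
    · rintro ⟨h1, -⟩
      have a1 := h1 p
      have a2 := h1 q
      have a3 := h1 r
      simp [hpq, hpq.symm, hpr, hpr.symm, hqr, hqr.symm] at a1 a2 a3
      exact ⟨a2, a3, by linarith⟩
    · rintro ⟨h1, h2, h3⟩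
      refine ⟨fun l => ?_, by simp [hpj.symm, hqj.symm, hrj.symm]⟩
      rcases cover_four hpq hpr hqr hpj hqj hrj l with rfl | rfl | rfl | rfl <;>
        simp [*, hpq.symm, hpr.symm, hqr.symm, hpj.symm, hqj.symm, hrj.symm]
      linarith
  · intro x hx
    rw [mem_facet] at hx
    have hs := T.coord_sum_four hpq hpr hqr hpj hqj hrj x
    refine ⟨(T.coord q x, T.coord r x), T.eq_of_coord_eq fun l => ?_⟩
    rw [coord_triMap]
    simp only [coord_vertex]
    rcases cover_four hpq hpr hqr hpj hqj hrj l with rfl | rfl | rfl | rfl <;>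
      simp [*, hpq.symm, hpr.symm, hqr.symm, hpj.symm, hqj.symm, hrj.symm]
    linarith

/-- Lebesgue measure on a tetrahedron. -/
theorem exists_restrict_body_three (T : Simplex 3) {p q r u : Fin 4} (hpq : p ≠ q)
    (hpr : p ≠ r) (hqr : q ≠ r) (hpu : p ≠ u) (hqu : q ≠ u) (hru : r ≠ u) :
    ∃ c : ℝ≥0, c ≠ 0 ∧ (volume : Measure (Space 3)).restrict T.body =
      c • (volume.restrict refTetrahedron).map (T.tetMap p q r u) := by
  have : (volume : Measure ((ℝ × ℝ) × ℝ)).IsAddHaarMeasure :=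
    Measure.prod.instIsAddHaarMeasure (volume : Measure (ℝ × ℝ)) (volume : Measure ℝ)
  obtain ⟨c, hc, h⟩ := exists_restrict_eq_smul_map (volume : Measure ((ℝ × ℝ) × ℝ))
    (T.tetMap p q r u) (T.tetMap_injective hpq hpr hqr hpu hqu hru)
  refine ⟨c, hc, ?_⟩
  rw [finrank_prod, finrank_prod, finrank_self,
    EuclideanSpace.euclideanHausdorffMeasure_eq_volume] at h
  rw [h _ ?_ T.isCompact_body.measurableSet]
  · congr 3
    ext t
    simp only [Set.mem_preimage, mem_body, coord_tetMap, coord_vertex, refTriangle,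
      refTetrahedron, Set.mem_ofPred_eq]
    constructor
    · intro h1
      have a1 := h1 p
      have a2 := h1 q
      have a3 := h1 r
      have a4 := h1 u
      simp [hpq, hpq.symm, hpr, hpr.symm, hqr, hqr.symm, hpu, hqu, hru, hpu.symm, hqu.symm,
        hru.symm] at a1 a2 a3 a4
      exact ⟨⟨a2, a3, by linarith⟩, a4, by linarith⟩
    · rintro ⟨⟨h1, h2, h3⟩, h4, h5⟩ l
      rcases cover_four hpq hpr hqr hpu hqu hru l with rfl | rfl | rfl | rfl <;>
        simp [*, hpq.symm, hpr.symm, hqr.symm, hpu.symm, hqu.symm, hru.symm]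
      linarith
  · intro x hx
    have hs := T.coord_sum_four hpq hpr hqr hpu hqu hru x
    refine ⟨((T.coord q x, T.coord r x), T.coord u x), T.eq_of_coord_eq fun l => ?_⟩
    rw [coord_tetMap]
    simp only [coord_vertex]
    rcases cover_four hpq hpr hqr hpu hqu hru l with rfl | rfl | rfl | rfl <;>
      simp [*, hpq.symm, hpr.symm, hqr.symm, hpu.symm, hqu.symm, hru.symm]
    linarith

end Simplex
end NonconformingFE

/-! ### Integrals over simplices as iterated integrals. -/

namespace NonconformingFE
open Module Measure
open scoped NNReal

/-- An injective affine map in finite dimension is a measurable embedding, so the change of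
variables needs no measurability or integrability of `f`. -/
theorem setIntegral_eq_mul_of_restrict_eq {E V : Type*} [NormedAddCommGroup E] [NormedSpace ℝ E]
    [FiniteDimensional ℝ E] [MeasurableSpace E] [BorelSpace E] [NormedAddCommGroup V]
    [NormedSpace ℝ V] [MeasurableSpace V] [BorelSpace V] {μ : Measure E}
    {ν : Measure V} {F : Set V} {S : Set E} {φ : E →ᵃ[ℝ] V} (hφ : Function.Injective φ)
    {c : ℝ≥0} (h : ν.restrict F = c • (μ.restrict S).map φ) (f : V → ℝ) :
    ∫ x in F, f x ∂ν = c * ∫ y in S, f (φ y) ∂μ := by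
  have hlin : Function.Injective φ.linear := (AffineMap.linear_injective_iff φ).2 hφ
  have hemb : MeasurableEmbedding φ := by
    have h1 := (LinearMap.isClosedEmbedding_of_injective
      (f := φ.linear) (LinearMap.ker_eq_bot.2 hlin)).measurableEmbedding
    have h2 : ⇑φ = (fun x => x + φ 0) ∘ φ.linear := by
      funext x; exact congrFun (AffineMap.decomp φ) x
    rw [h2]
    exact (measurableEmbedding_addRight (φ 0)).comp h1
  rw [h, integral_smul_nnreal_measure, hemb.integral_map]
  rfl

/-- Finiteness of the surface measure of a facet is what makes continuous functions integrable
there; it is inherited from the reference domain. -/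
theorem measure_ne_top_of_restrict_eq {E V : Type*} [MeasurableSpace E] [MeasurableSpace V]
    {μ : Measure E} {ν : Measure V} {F : Set V} {S : Set E} {φ : E → V} (hS : μ S ≠ ⊤)
    {c : ℝ≥0} (h : ν.restrict F = c • (μ.restrict S).map φ) : ν F ≠ ⊤ := by
  have : IsFiniteMeasure (μ.restrict S) := ⟨by simpa using hS.lt_top⟩
  have h2 : ν F = (c • (μ.restrict S).map φ) Set.univ := by simp [← h]
  rw [h2]
  exact measure_ne_top _ _

/-- Fubini for the region between zero and a nonnegative function. -/
theorem setIntegral_region {E : Type*} [MeasurableSpace E] {μ : Measure E} [SFinite μ]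
    {B : Set E} (hB : MeasurableSet B) {g : E → ℝ} (hg : ∀ x ∈ B, 0 ≤ g x)
    {R : Set (E × ℝ)} (hR : MeasurableSet R)
    (hRB : ∀ x, x ∈ R ↔ x.1 ∈ B ∧ 0 ≤ x.2 ∧ x.2 ≤ g x.1)
    {f : E × ℝ → ℝ} (hf : IntegrableOn f R (μ.prod volume)) :
    ∫ x in R, f x ∂(μ.prod volume) =
      ∫ x in B, (∫ t in (0 : ℝ)..g x, f (x, t)) ∂μ := by
  rw [← integral_indicator hR, integral_prod _ (hf.integrable_indicator hR),
    ← integral_indicator hB]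
  congr 1
  funext x
  by_cases hx : x ∈ B
  · rw [Set.indicator_of_mem hx, intervalIntegral.integral_of_le (hg x hx),
      ← integral_Icc_eq_integral_Ioc, ← integral_indicator measurableSet_Icc]
    congr 1
    funext t
    simp only [Set.indicator, hRB, hx, true_and, Set.mem_Icc]
  · rw [Set.indicator_of_notMem hx]
    refine integral_eq_zero_of_ae (Filter.Eventually.of_forall fun t => ?_)
    simp [Set.indicator, hRB, hx]

namespace Simplex

theorem isCompact_refTriangle : IsCompact refTriangle := by
  refine (isCompact_Icc.prod isCompact_Icc : IsCompact (Set.Icc (0 : ℝ) 1 ×ˢ Set.Icc (0 : ℝ) 1))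
    |>.of_isClosed_subset ?_ ?_
  · exact (isClosed_le continuous_const continuous_fst).inter
      ((isClosed_le continuous_const continuous_snd).inter
        (isClosed_le (continuous_fst.add continuous_snd) continuous_const))
  · rintro ⟨s, t⟩ ⟨h1, h2, h3⟩
    simp only at h1 h2 h3
    exact ⟨⟨h1, by linarith⟩, ⟨h2, by linarith⟩⟩

theorem isCompact_refTetrahedron : IsCompact refTetrahedron := by
  refine (isCompact_refTriangle.prod isCompact_Icc :
    IsCompact (refTriangle ×ˢ Set.Icc (0 : ℝ) 1)) |>.of_isClosed_subset ?_ ?_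
  · exact (isCompact_refTriangle.isClosed.preimage continuous_fst).inter
      ((isClosed_le continuous_const continuous_snd).inter
        (isClosed_le continuous_snd (by fun_prop)))
  · rintro ⟨⟨s, t⟩, u⟩ ⟨h, h4, h5⟩
    obtain ⟨h1, h2, h3⟩ := h
    simp only at h1 h2 h3 h4 h5
    exact ⟨⟨h1, h2, h3⟩, ⟨h4, by linarith⟩⟩

theorem setIntegral_refTriangle {f : ℝ × ℝ → ℝ} (hf : Continuous f) :
    ∫ x in refTriangle, f x = ∫ s in (0 : ℝ)..1, ∫ t in (0 : ℝ)..1 - s, f (s, t) := by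
  rw [intervalIntegral.integral_of_le zero_le_one, ← integral_Icc_eq_integral_Ioc]
  refine setIntegral_region (g := fun s => 1 - s) measurableSet_Icc
    (fun x hx => by linarith [hx.2])
    isCompact_refTriangle.measurableSet (fun x => ?_)
    (hf.continuousOn.integrableOn_compact isCompact_refTriangle)
  constructor
  · rintro ⟨h1, h2, h3⟩
    exact ⟨⟨h1, by linarith⟩, h2, by linarith⟩
  · rintro ⟨⟨h1, h2⟩, h3, h4⟩
    exact ⟨h1, h3, by linarith⟩

theorem setIntegral_refTetrahedron {f : (ℝ × ℝ) × ℝ → ℝ} (hf : Continuous f) :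
    ∫ x in refTetrahedron, f x =
      ∫ x in refTriangle, ∫ t in (0 : ℝ)..1 - x.1 - x.2, f (x, t) :=
  setIntegral_region (g := fun x => 1 - x.1 - x.2) isCompact_refTriangle.measurableSet
    (fun x hx => by linarith [hx.2.2]) isCompact_refTetrahedron.measurableSet (fun x => Iff.rfl)
    (hf.continuousOn.integrableOn_compact isCompact_refTetrahedron)

theorem exists_integral_facet_two (T : Simplex 2) {p q j : Fin 3} (hpq : p ≠ q)
    (hpj : p ≠ j) (hqj : q ≠ j) :
    ∃ c : ℝ, c ≠ 0 ∧ ∀ f : Space 2 → ℝ,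
      ∫ x in T.facet j, f x ∂μHE[1] = c * ∫ t in (0 : ℝ)..1, f (T.edgeMap p q t) := by
  obtain ⟨c, hc, h⟩ := T.exists_restrict_facet_two hpq hpj hqj
  refine ⟨c, by exact_mod_cast hc, fun f => ?_⟩
  rw [setIntegral_eq_mul_of_restrict_eq (T.edgeMap_injective hpq) h,
    intervalIntegral.integral_of_le zero_le_one, ← integral_Icc_eq_integral_Ioc]

theorem exists_integral_body_two (T : Simplex 2) {p q r : Fin 3} (hpq : p ≠ q)
    (hpr : p ≠ r) (hqr : q ≠ r) :
    ∃ c : ℝ, c ≠ 0 ∧ ∀ f : Space 2 → ℝ,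
      ∫ x in T.body, f x = c * ∫ x in refTriangle, f (T.triMap p q r x) := by
  obtain ⟨c, hc, h⟩ := T.exists_restrict_body_two hpq hpr hqr
  exact ⟨c, by exact_mod_cast hc,
    setIntegral_eq_mul_of_restrict_eq (T.triMap_injective hpq hpr hqr) h⟩

/-- In dimension three integrals are only shown to vanish, so `c ≠ 0` is not recorded. In dimension
two it is, because there vanishing moments are pulled back to the reference domain. -/
theorem exists_integral_facet_three (T : Simplex 3) {p q r j : Fin 4} (hpq : p ≠ q)
    (hpr : p ≠ r) (hqr : q ≠ r) (hpj : p ≠ j) (hqj : q ≠ j) (hrj : r ≠ j) :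
    ∃ c : ℝ, ∀ f : Space 3 → ℝ,
      ∫ x in T.facet j, f x ∂μHE[2] = c * ∫ x in refTriangle, f (T.triMap p q r x) := by
  obtain ⟨c, -, h⟩ := T.exists_restrict_facet_three hpq hpr hqr hpj hqj hrj
  exact ⟨c, setIntegral_eq_mul_of_restrict_eq (T.triMap_injective hpq hpr hqr) h⟩

theorem exists_integral_body_three (T : Simplex 3) {p q r u : Fin 4} (hpq : p ≠ q)
    (hpr : p ≠ r) (hqr : q ≠ r) (hpu : p ≠ u) (hqu : q ≠ u) (hru : r ≠ u) :
    ∃ c : ℝ, ∀ f : Space 3 → ℝ,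
      ∫ x in T.body, f x = c * ∫ x in refTetrahedron, f (T.tetMap p q r u x) := by
  obtain ⟨c, -, h⟩ := T.exists_restrict_body_three hpq hpr hqr hpu hqu hru
  exact ⟨c, setIntegral_eq_mul_of_restrict_eq (T.tetMap_injective hpq hpr hqr hpu hqu hru) h⟩

theorem facet_two_ne_top (T : Simplex 2) (j : Fin 3) : μHE[1] (T.facet j) ≠ ⊤ := by
  have : ∃ p q : Fin 3, p ≠ q ∧ p ≠ j ∧ q ≠ j := by decide +revert
  obtain ⟨p, q, hpq, hpj, hqj⟩ := this
  obtain ⟨c, -, h⟩ := T.exists_restrict_facet_two hpq hpj hqj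
  exact measure_ne_top_of_restrict_eq (by simp) h

theorem facet_three_ne_top (T : Simplex 3) (j : Fin 4) : μHE[2] (T.facet j) ≠ ⊤ := by
  have : ∃ p q r : Fin 4, p ≠ q ∧ p ≠ r ∧ q ≠ r ∧ p ≠ j ∧ q ≠ j ∧ r ≠ j := by decide +revert
  obtain ⟨p, q, r, hpq, hpr, hqr, hpj, hqj, hrj⟩ := this
  obtain ⟨c, -, h⟩ := T.exists_restrict_facet_three hpq hpr hqr hpj hqj hrj
  exact measure_ne_top_of_restrict_eq isCompact_refTriangle.measure_lt_top.ne h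

end Simplex
end NonconformingFE

/-! ### Barycentric and Cartesian polynomials as weights. -/

namespace NonconformingFE
open Module Measure

section Calculus

variable {σ 𝕜 : Type*} [Fintype σ] [NormedField 𝕜] [NormedAlgebra ℝ 𝕜]

/-- The chain rule along a curve. The scalars are general because it is applied over `ℝ` to lines in
a triangle and over `ℂ` to the Cauchy-Riemann equation. -/
theorem hasDerivAt_eval (f : MvPolynomial σ 𝕜) {γ : ℝ → σ → 𝕜} {γ' : σ → 𝕜} {t : ℝ}
    (h : ∀ i, HasDerivAt (fun s => γ s i) (γ' i) t) :
    HasDerivAt (fun s => MvPolynomial.eval (γ s) f)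
      (∑ i, MvPolynomial.eval (γ t) (MvPolynomial.pderiv i f) * γ' i) t := by
  classical
  induction f using MvPolynomial.induction_on with
  | C a => simpa using hasDerivAt_const t a
  | add p q hp hq =>
    simp only [map_add, add_mul, Finset.sum_add_distrib]
    exact hp.add hq
  | mul_X p i hp =>
    simp only [map_mul, MvPolynomial.eval_X]
    refine (hp.mul (h i)).congr_deriv ?_
    symm
    simp only [Derivation.leibniz, MvPolynomial.pderiv_X, smul_eq_mul, map_add, map_mul,
      MvPolynomial.eval_X, add_mul, Finset.sum_add_distrib, Pi.single_apply,
      Finset.sum_mul]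
    rw [add_comm]
    congr 1
    · exact Finset.sum_congr rfl fun _ _ => by ring
    · rw [Finset.sum_eq_single i] <;> simp +contextual [eq_comm]

omit [Fintype σ] in
theorem totalDegree_pderiv_le {R : Type*} [CommSemiring R] (i : σ) {f : MvPolynomial σ R} {n : ℕ}
    (h : f.totalDegree ≤ n) : (MvPolynomial.pderiv i f).totalDegree ≤ n - 1 := by
  rw [MvPolynomial.totalDegree, Finset.sup_le_iff]
  intro m hm
  rw [MvPolynomial.mem_support_iff, MvPolynomial.coeff_pderiv] at hm
  have h1 := MvPolynomial.le_totalDegree (MvPolynomial.mem_support_iff.2 (left_ne_zero_of_mul hm))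
  rw [Finsupp.sum_add_index' (by simp) (by simp), Finsupp.sum_single_index rfl] at h1
  omega

end Calculus

namespace Simplex
variable {d : ℕ} (T : Simplex d)

/-- The span of the barycentric monomials of degree `n`. -/
def barySpan (n : ℕ) : Submodule ℝ (Space d → ℝ) :=
  Submodule.span ℝ {f | ∃ α : Fin (d + 1) → ℕ, ∑ l, α l = n ∧ T.baryMonomial α = f}

theorem one_mem_barySpan_zero : 1 ∈ T.barySpan 0 :=
  Submodule.subset_span ⟨0, by simp, by funext x; simp [baryMonomial]⟩

theorem mul_mem_barySpan {a b : ℕ} {f g : Space d → ℝ} (hf : f ∈ T.barySpan a)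
    (hg : g ∈ T.barySpan b) : f * g ∈ T.barySpan (a + b) := by
  have h := Submodule.mul_mem_mul hf hg
  rw [barySpan, barySpan, Submodule.span_mul_span] at h
  refine Submodule.span_mono ?_ h
  rintro _ ⟨_, ⟨α, hα, rfl⟩, _, ⟨β, hβ, rfl⟩, rfl⟩
  refine ⟨α + β, by simp [Finset.sum_add_distrib, hα, hβ], ?_⟩
  funext x
  simp [baryMonomial, pow_add, Finset.prod_mul_distrib]

theorem coord_mem_barySpan (l : Fin (d + 1)) : (T.coord l : Space d → ℝ) ∈ T.barySpan 1 := by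
  classical
  refine Submodule.subset_span ⟨Pi.single l 1, by simp, ?_⟩
  funext x
  rw [baryMonomial, Finset.prod_eq_single l] <;> simp +contextual

/-- The partition of unity homogenizes: multiplying by powers of `1 = ∑ λ_l` raises any lower-degree
term to the prescribed degree. -/
theorem one_mem_barySpan_one : 1 ∈ T.barySpan 1 := by
  have : (1 : Space d → ℝ) = ∑ l, (T.coord l : Space d → ℝ) := by
    funext x; simp [Finset.sum_apply, T.sum_coord]
  rw [this]
  exact Submodule.sum_mem _ fun l _ => T.coord_mem_barySpan l

theorem apply_mem_barySpan_one (i : Fin d) : (fun x : Space d => x i) ∈ T.barySpan 1 := by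
  have : (fun x : Space d => x i) = ∑ l, (T l i) • (T.coord l : Space d → ℝ) := by
    funext x
    have h := congrArg (fun y : Space d => y i) (T.linear_combination_coord_eq_self x)
    simp only [WithLp.ofLp_sum, WithLp.ofLp_smul, Finset.sum_apply, Pi.smul_apply,
      smul_eq_mul] at h ⊢
    rw [← h]
    exact Finset.sum_congr rfl fun l _ => mul_comm _ _
  rw [this]
  exact Submodule.sum_mem _ fun l _ => Submodule.smul_mem _ _ (T.coord_mem_barySpan l)

theorem pow_mem_barySpan {f : Space d → ℝ} (hf : f ∈ T.barySpan 1) (n : ℕ) :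
    f ^ n ∈ T.barySpan n := by
  induction n with
  | zero => simpa using T.one_mem_barySpan_zero
  | succ n ih => rw [pow_succ]; exact T.mul_mem_barySpan ih hf

theorem prod_mem_barySpan {ι : Type*} (s : Finset ι) (f : ι → Space d → ℝ) (m : ι → ℕ)
    (hf : ∀ i, f i ∈ T.barySpan 1) : ∏ i ∈ s, f i ^ m i ∈ T.barySpan (∑ i ∈ s, m i) := by
  classical
  induction s using Finset.induction_on with
  | empty => simpa using T.one_mem_barySpan_zero
  | insert a s ha ih =>
    rw [Finset.prod_insert ha, Finset.sum_insert ha]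
    exact T.mul_mem_barySpan (T.pow_mem_barySpan (hf a) _) ih

theorem eval_mem_barySpan {n : ℕ} {g : MvPolynomial (Fin d) ℝ} (hg : g.totalDegree ≤ n) :
    (fun x : Space d => MvPolynomial.eval (fun j => x j) g) ∈ T.barySpan n := by
  have h : (fun x : Space d => MvPolynomial.eval (fun j => x j) g) =
      ∑ m ∈ g.support, g.coeff m • ((∏ i ∈ m.support, (fun x : Space d => x i) ^ m i) *
        1 ^ (n - ∑ i ∈ m.support, m i)) := by
    funext x
    rw [MvPolynomial.eval_eq]
    simp
  rw [h]
  refine Submodule.sum_mem _ fun m hm => Submodule.smul_mem _ _ ?_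
  have hle : ∑ i ∈ m.support, m i ≤ n := (MvPolynomial.le_totalDegree hm).trans hg
  have := T.mul_mem_barySpan (T.prod_mem_barySpan m.support _ m T.apply_mem_barySpan_one)
    (T.pow_mem_barySpan T.one_mem_barySpan_one (n - ∑ i ∈ m.support, m i))
  rwa [Nat.add_sub_cancel' hle] at this

theorem continuous_baryMonomial (α : Fin (d + 1) → ℕ) : Continuous (T.baryMonomial α) :=
  continuous_finsetProd _ fun l _ => (T.continuous_coord l).pow _

end Simplex

theorem continuous_eval_space {d : ℕ} (g : MvPolynomial (Fin d) ℝ) :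
    Continuous fun x : Space d => MvPolynomial.eval (fun j => x j) g :=
  (MvPolynomial.continuous_eval g).comp (by fun_prop)

theorem integrableOn_of_continuous {d : ℕ} {F : Set (Space d)} (hF : IsCompact F)
    {ν : Measure (Space d)} (hν : ν F ≠ ⊤) {f : Space d → ℝ} (hf : Continuous f) :
    IntegrableOn f F ν :=
  hf.continuousOn.integrableOn_of_subset_isCompact hF hF.measurableSet subset_rfl hν

theorem integral_mul_inner_value {d : ℕ} {F : Set (Space d)} (hF : IsCompact F)
    {ν : Measure (Space d)} (hν : ν F ≠ ⊤) {f : Space d → ℝ} (hf : Continuous f)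
    (v : VField d) (y : Space d) :
    ∫ x in F, f x * inner ℝ (v.value x) y ∂ν =
      inner ℝ (WithLp.toLp 2 fun m => ∫ x in F, f x * MvPolynomial.eval (fun j => x j) (v m) ∂ν :
        Space d) y := by
  simp only [PiLp.inner_apply, VField.value, Finset.mul_sum]
  rw [integral_finsetSum]
  · refine Finset.sum_congr rfl fun m _ => ?_
    simp only [RCLike.inner_apply, conj_trivial]
    rw [← integral_const_mul]
    exact integral_congr_ae (.of_forall fun x => by simp only; ring)
  · intro m _
    refine integrableOn_of_continuous hF hν (hf.mul ?_)
    simp only [RCLike.inner_apply, conj_trivial]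
    exact continuous_const.mul (continuous_eval_space _)

/-- The weighted integral of `v` is one vector, and a vector vanishes when its products with any
basis do, orthonormal or not. This removes `e` from the problem. -/
theorem integral_mul_inner_value_eq_zero_iff {d : ℕ} {F : Set (Space d)} (hF : IsCompact F)
    {ν : Measure (Space d)} (hν : ν F ≠ ⊤) {f : Space d → ℝ} (hf : Continuous f)
    (v : VField d) (e : Basis (Fin d) ℝ (Space d)) :
    (∀ i, ∫ x in F, f x * inner ℝ (v.value x) (e i) ∂ν = 0) ↔
      ∀ m, ∫ x in F, f x * MvPolynomial.eval (fun j => x j) (v m) ∂ν = 0 := by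
  simp only [integral_mul_inner_value hF hν hf]
  constructor
  · intro h m
    have h2 := InnerProductSpace.ext_inner_right_basis e (y := 0) (fun i => by rw [h i, inner_zero_left])
    exact congrArg (fun z : Space d => z m) h2
  · intro h i
    simp only [h]
    exact inner_zero_left _

/-- A linear functional given by integration, vanishing on barycentric monomials of degree `n`,
vanishes on polynomials of degree at most `n`. -/
theorem integral_eval_mul_eq_zero {d n : ℕ} (T : Simplex d) {F : Set (Space d)} (hF : IsCompact F)
    {ν : Measure (Space d)} (hν : ν F ≠ ⊤) {f : Space d → ℝ} (hf : Continuous f)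
    (h : ∀ α : Fin (d + 1) → ℕ, ∑ l, α l = n → ∫ x in F, T.baryMonomial α x * f x ∂ν = 0)
    {g : MvPolynomial (Fin d) ℝ} (hg : g.totalDegree ≤ n) :
    ∫ x in F, MvPolynomial.eval (fun j => x j) g * f x ∂ν = 0 := by
  suffices ∀ u ∈ T.barySpan n, Continuous u ∧ ∫ x in F, u x * f x ∂ν = 0 from
    (this _ (T.eval_mem_barySpan hg)).2
  intro u hu
  induction hu using Submodule.span_induction with
  | mem u hu =>
    obtain ⟨α, hα, rfl⟩ := hu
    exact ⟨T.continuous_baryMonomial α, h α hα⟩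
  | zero => exact ⟨continuous_const, by simp⟩
  | add u w _ _ hu hw =>
    refine ⟨hu.1.add hw.1, ?_⟩
    simp only [Pi.add_apply, add_mul]
    rw [integral_add (f := fun x => u x * f x) (g := fun x => w x * f x)
      (integrableOn_of_continuous hF hν (hu.1.mul hf))
      (integrableOn_of_continuous hF hν (hw.1.mul hf)), hu.2, hw.2, add_zero]
  | smul c u _ hu =>
    refine ⟨continuous_const.smul hu.1, ?_⟩
    simp only [Pi.smul_apply, smul_eq_mul, mul_assoc]
    rw [integral_const_mul, hu.2, mul_zero]

end NonconformingFE

/-! ### Integration by parts on a triangle. -/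

namespace NonconformingFE
open Module Measure


namespace Simplex

theorem triMap_hypotenuse {d : ℕ} (T : Simplex d) (p q r : Fin (d + 1)) (s : ℝ) :
    T.triMap p q r (s, 1 - s) = T.edgeMap r q s := by
  rw [triMap_apply, edgeMap_apply]; module

theorem triMap_zero_right {d : ℕ} (T : Simplex d) (p q r : Fin (d + 1)) (s : ℝ) :
    T.triMap p q r (s, 0) = T.edgeMap p q s := by
  simp [triMap_apply, edgeMap_apply]

theorem hasDerivAt_eval_triMap {d : ℕ} (T : Simplex d) (p q r : Fin (d + 1))
    (f : MvPolynomial (Fin d) ℝ) (s t : ℝ) :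
    HasDerivAt (fun t => MvPolynomial.eval (fun j => T.triMap p q r (s, t) j) f)
      (∑ i, (T r - T p) i *
        MvPolynomial.eval (fun j => T.triMap p q r (s, t) j) (MvPolynomial.pderiv i f)) t := by
  have h : ∀ i, HasDerivAt (fun t => T.triMap p q r (s, t) i) ((T r - T p) i) t := by
    intro i
    simp only [triMap_apply, PiLp.add_apply, PiLp.smul_apply, smul_eq_mul]
    simpa using ((hasDerivAt_id t).mul_const ((T r - T p) i)).const_add
      (T p i + s * (T q - T p) i)
  refine (hasDerivAt_eval f h).congr_deriv ?_
  exact Finset.sum_congr rfl fun i _ => mul_comm _ _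

theorem continuous_triMap {d : ℕ} (T : Simplex d) (p q r : Fin (d + 1)) :
    Continuous (T.triMap p q r) := (T.triMap p q r).continuous_of_finiteDimensional

/-- Integrating a directional derivative along an edge direction of a triangle. -/
theorem integral_refTriangle_deriv {d : ℕ} (T : Simplex d) (p q r : Fin (d + 1))
    (f : MvPolynomial (Fin d) ℝ) :
    ∫ x in refTriangle, (∑ i, (T r - T p) i *
        MvPolynomial.eval (fun j => T.triMap p q r x j) (MvPolynomial.pderiv i f)) =
      (∫ s in (0 : ℝ)..1, MvPolynomial.eval (fun j => T.edgeMap r q s j) f) -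
        ∫ s in (0 : ℝ)..1, MvPolynomial.eval (fun j => T.edgeMap p q s j) f := by
  have hc : ∀ g : MvPolynomial (Fin d) ℝ,
      Continuous fun x => MvPolynomial.eval (fun j => T.triMap p q r x j) g := fun g =>
    (continuous_eval_space g).comp (T.continuous_triMap p q r)
  have he : ∀ p q, Continuous fun s => MvPolynomial.eval (fun j => T.edgeMap p q s j) f :=
    fun p q => (continuous_eval_space f).comp (T.edgeMap p q).continuous_of_finiteDimensional
  have hs : Continuous fun x => ∑ i, (T r - T p) i *
      MvPolynomial.eval (fun j => T.triMap p q r x j) (MvPolynomial.pderiv i f) :=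
    continuous_finsetSum _ fun i _ => continuous_const.mul (hc _)
  rw [setIntegral_refTriangle hs,
    ← intervalIntegral.integral_sub ((he r q).intervalIntegrable _ _)
      ((he p q).intervalIntegrable _ _)]
  refine intervalIntegral.integral_congr fun s _ => ?_
  simp only
  -- For fixed `s`, the variable `t` moves in the direction `T r - T p` from a point of the edge
  -- `pq` to a point of the edge `rq`.
  rw [intervalIntegral.integral_eq_sub_of_hasDerivAt
    (fun t _ => T.hasDerivAt_eval_triMap p q r f s t), T.triMap_hypotenuse, T.triMap_zero_right]
  refine Continuous.intervalIntegrable ?_ _ _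
  exact continuous_finsetSum _ fun i _ =>
    continuous_const.mul ((hc _).comp (by fun_prop : Continuous fun t : ℝ => (s, t)))

/-- The linear form `x ↦ x · y` takes one value at all vertices, hence at all points by barycentric
coordinates. Comparing the points `y` and `0` gives `|y|² = 0`. -/
theorem eq_zero_of_inner_sub_eq_zero {d : ℕ} (T : Simplex d) (y : Space d)
    (h : ∀ p r, p ≠ r → ∑ i, (T r - T p) i * y i = 0) : y = 0 := by
  have h0 : ∀ l, ∑ i, T l i * y i = ∑ i, T 0 i * y i := by
    intro l
    by_cases hl : (0 : Fin (d + 1)) = l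
    · rw [← hl]
    · have := h 0 l hl
      simp only [PiLp.sub_apply, sub_mul, Finset.sum_sub_distrib] at this
      linarith
  have h1 : ∀ x : Space d, ∑ i, x i * y i = ∑ i, T 0 i * y i := by
    intro x
    have hx : ∀ i, x i = ∑ l, T.coord l x * T l i := by
      intro i
      have := congrArg (fun y : Space d => y i) (T.linear_combination_coord_eq_self x)
      simpa only [WithLp.ofLp_sum, WithLp.ofLp_smul, Finset.sum_apply, Pi.smul_apply,
        smul_eq_mul, eq_comm] using this
    calc ∑ i, x i * y i = ∑ i, (∑ l, T.coord l x * T l i) * y i :=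
          Finset.sum_congr rfl fun i _ => by rw [← hx i]
      _ = ∑ l, T.coord l x * ∑ i, T l i * y i := by
          simp only [Finset.sum_mul, Finset.mul_sum, mul_assoc]
          exact Finset.sum_comm
      _ = ∑ i, T 0 i * y i := by
          simp only [h0, ← Finset.sum_mul, T.sum_coord, one_mul]
  have h2 : ∑ i, y i * y i = 0 := by
    rw [h1 y, ← h1 0]
    simp
  ext i
  rw [Finset.sum_eq_zero_iff_of_nonneg fun i _ => mul_self_nonneg _] at h2
  simpa using h2 i (Finset.mem_univ i)

/-- If all edge integrals of a polynomial vanish, then so do the integrals of its partial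
derivatives over the triangle. -/
theorem integral_pderiv_eq_zero (T : Simplex 2) (f : MvPolynomial (Fin 2) ℝ)
    (h : ∀ j, ∫ x in T.facet j, MvPolynomial.eval (fun j => x j) f ∂μHE[1] = 0) (i : Fin 2) :
    ∫ x in T.body, MvPolynomial.eval (fun j => x j) (MvPolynomial.pderiv i f) = 0 := by
  have hedge : ∀ p q : Fin 3, p ≠ q →
      ∫ s in (0 : ℝ)..1, MvPolynomial.eval (fun j => T.edgeMap p q s j) f = 0 := by
    intro p q hpq
    obtain ⟨j, hpj, hqj⟩ : ∃ j : Fin 3, p ≠ j ∧ q ≠ j := by decide +revert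
    obtain ⟨c, hc, hI⟩ := T.exists_integral_facet_two hpq hpj hqj
    have := h j
    rw [hI] at this
    exact (mul_eq_zero.1 this).resolve_left hc
  have hy := T.eq_zero_of_inner_sub_eq_zero
    (WithLp.toLp 2 fun i => ∫ x in T.body,
      MvPolynomial.eval (fun j => x j) (MvPolynomial.pderiv i f)) ?_
  · exact congrArg (fun z : Space 2 => z i) hy
  intro p r hpr
  obtain ⟨q, hpq, hqr⟩ : ∃ q : Fin 3, p ≠ q ∧ q ≠ r := by decide +revert
  obtain ⟨c, hc, hI⟩ := T.exists_integral_body_two hpq hpr hqr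
  have key := hI fun x => ∑ i, (T r - T p) i *
    MvPolynomial.eval (fun j => x j) (MvPolynomial.pderiv i f)
  rw [T.integral_refTriangle_deriv, hedge r q hqr.symm, hedge p q hpq, sub_zero, mul_zero,
    integral_finsetSum] at key
  · simp only [integral_const_mul] at key
    exact key
  · exact fun i _ => integrableOn_of_continuous T.isCompact_body T.isCompact_body.measure_lt_top.ne
      (continuous_const.mul (continuous_eval_space _))

/-- A polynomial whose square has zero integral over a simplex is zero. -/
theorem eq_zero_of_integral_sq_eq_zero {d : ℕ} (T : Simplex d) {g : MvPolynomial (Fin d) ℝ}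
    (h : ∫ x in T.body, MvPolynomial.eval (fun j => x j) g *
      MvPolynomial.eval (fun j => x j) g = 0) : g = 0 := by
  have hc := continuous_eval_space g
  rw [setIntegral_eq_zero_iff_of_nonneg_ae (.of_forall fun x => mul_self_nonneg _)
    (integrableOn_of_continuous T.isCompact_body T.isCompact_body.measure_lt_top.ne
      (hc.mul hc))] at h
  have h2 : Set.EqOn (fun x : Space d => MvPolynomial.eval (fun j => x j) g) (fun _ => 0)
      (interior T.body) := by
    refine Measure.eqOn_open_of_ae_eq (μ := volume) ?_ isOpen_interior hc.continuousOn
      continuousOn_const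
    refine ae_mono (Measure.restrict_mono interior_subset le_rfl) ?_
    filter_upwards [h] with x hx
    simpa using hx
  obtain ⟨z, hz⟩ : (interior T.body).Nonempty :=
    ⟨_, T.centroid_mem_interior_convexHull⟩
  -- An open box around an interior point is a product of infinite sets, and a polynomial vanishing
  -- on such a product is zero.
  have ho : IsOpen ((WithLp.toLp 2 : (Fin d → ℝ) → Space d) ⁻¹' interior T.body) :=
    isOpen_interior.preimage (PiLp.continuous_toLp 2 _)
  rw [isOpen_pi_iff'] at ho
  obtain ⟨u, hu, hsub⟩ := ho z.ofLp hz
  refine MvPolynomial.funext_set u (fun i => ?_) fun x hx => ?_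
  · exact infinite_of_mem_nhds (z i) ((hu i).1.mem_nhds (hu i).2)
  · simpa using h2 (hsub hx)

end Simplex

/-! ### Vanishing moments force zero divergence and curl. -/

/-- The moments of order `k` on a triangle, tested against Cartesian polynomials. -/
structure VanishingMoments (k : ℕ) (T : Simplex 2) (v : VField 2) : Prop where
  body : ∀ m (g : MvPolynomial (Fin 2) ℝ), g.totalDegree + 2 ≤ k →
    ∫ x in T.body, MvPolynomial.eval (fun j => x j) g * MvPolynomial.eval (fun j => x j) (v m) = 0
  facet : ∀ j m (g : MvPolynomial (Fin 2) ℝ), g.totalDegree + 1 ≤ k →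
    ∫ x in T.facet j, MvPolynomial.eval (fun j => x j) g *
      MvPolynomial.eval (fun j => x j) (v m) ∂μHE[1] = 0

theorem VanishingMoments.of_moment_eq_zero {k : ℕ} {T : Simplex 2} {v : VField 2}
    {e : Basis (Fin 2) ℝ (Space 2)}
    (h : ∀ ι : InteriorIndex k 2 ⊕ FacetIndex k 2, moment T e ι v = 0) :
    VanishingMoments k T v where
  body m g hg := by
    refine integral_eval_mul_eq_zero (n := k - 2) T T.isCompact_body
      T.isCompact_body.measure_lt_top.ne (continuous_eval_space _) (fun α hα => ?_) (by omega)
    refine (integral_mul_inner_value_eq_zero_iff T.isCompact_body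
      T.isCompact_body.measure_lt_top.ne (T.continuous_baryMonomial α) v e).1 (fun i => ?_) m
    exact h (Sum.inl (i, ⟨α, by omega⟩))
  facet j m g hg := by
    refine integral_eval_mul_eq_zero (n := k - 1) T (T.isCompact_facet j)
      (T.facet_two_ne_top j) (continuous_eval_space _) (fun α hα => ?_) (by omega)
    by_cases hj : α j = 0
    · refine (integral_mul_inner_value_eq_zero_iff (T.isCompact_facet j)
        (T.facet_two_ne_top j) (T.continuous_baryMonomial α) v e).1 (fun i => ?_) m
      exact h (Sum.inr (i, ⟨j, ⟨α, by omega, hj⟩⟩))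
    -- A monomial containing `λ_j` vanishes on `F_j`, so the restriction `β_j = 0` in the index set
    -- loses no test functions.
    · refine setIntegral_eq_zero_of_forall_eq_zero fun x hx => ?_
      have : T.baryMonomial α x = 0 :=
        Finset.prod_eq_zero (Finset.mem_univ j) (by rw [hx.2, zero_pow hj])
      rw [this, zero_mul]

/-- Integrate `∂_i (r v_m)`: the edge integrals of `r v_m` are edge moments of degree at most `k -
1`, and `v_m ∂_i r` gives an interior moment of degree at most `k - 2`. -/
theorem VanishingMoments.integral_pderiv_mul_eq_zero {k : ℕ} {T : Simplex 2} {v : VField 2}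
    (h : VanishingMoments k T v) (i m : Fin 2) {r : MvPolynomial (Fin 2) ℝ}
    (hr : r.totalDegree + 1 ≤ k) :
    ∫ x in T.body, MvPolynomial.eval (fun j => x j) (MvPolynomial.pderiv i (v m)) *
      MvPolynomial.eval (fun j => x j) r = 0 := by
  have h1 := T.integral_pderiv_eq_zero (r * v m)
    (fun j => by simpa only [map_mul] using h.facet j m r hr) i
  have h2 : ∫ x in T.body, MvPolynomial.eval (fun j => x j) (MvPolynomial.pderiv i r) *
      MvPolynomial.eval (fun j => x j) (v m) = 0 := by
    -- Constants are separated because for `k = 1` there are no interior moments at all; the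
    -- derivative is then zero anyway.
    by_cases hk : r.totalDegree = 0
    · rw [MvPolynomial.totalDegree_eq_zero_iff_eq_C.1 hk]
      simp
    · have := totalDegree_pderiv_le i (le_refl r.totalDegree)
      exact h.body m _ (by omega)
  simp only [Derivation.leibniz, smul_eq_mul, map_add, map_mul] at h1
  have hint : ∀ a b : MvPolynomial (Fin 2) ℝ, IntegrableOn (fun x : Space 2 =>
      MvPolynomial.eval (fun j => x j) a * MvPolynomial.eval (fun j => x j) b) T.body := fun a b =>
    integrableOn_of_continuous T.isCompact_body T.isCompact_body.measure_lt_top.ne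
      ((continuous_eval_space _).mul (continuous_eval_space _))
  rw [integral_add (hint _ _) (hint _ _)] at h1
  simp only [mul_comm (MvPolynomial.eval _ (v m))] at h1
  rw [h2, add_zero] at h1
  simpa only [mul_comm] using h1

/-- The combination has low enough degree to serve as its own test function. The values `c = 1` and
`c = -1` yield divergence and curl. -/
theorem VanishingMoments.pderiv_combination_eq_zero {k : ℕ} {T : Simplex 2} {v : VField 2}
    (h : VanishingMoments k T v) (i m i' m' : Fin 2) (c : ℝ)
    (hdeg : (MvPolynomial.pderiv i (v m) +
      MvPolynomial.C c * MvPolynomial.pderiv i' (v m')).totalDegree + 1 ≤ k) :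
    MvPolynomial.pderiv i (v m) + MvPolynomial.C c * MvPolynomial.pderiv i' (v m') = 0 := by
  refine T.eq_zero_of_integral_sq_eq_zero ?_
  have h1 := h.integral_pderiv_mul_eq_zero i m hdeg
  have h2 := h.integral_pderiv_mul_eq_zero i' m' hdeg
  set D := MvPolynomial.pderiv i (v m) + MvPolynomial.C c * MvPolynomial.pderiv i' (v m') with hD
  have hint : ∀ a b : MvPolynomial (Fin 2) ℝ, IntegrableOn (fun x : Space 2 =>
      MvPolynomial.eval (fun j => x j) a * MvPolynomial.eval (fun j => x j) b) T.body := fun a b =>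
    integrableOn_of_continuous T.isCompact_body T.isCompact_body.measure_lt_top.ne
      ((continuous_eval_space _).mul (continuous_eval_space _))
  calc _ = ∫ x in T.body, (MvPolynomial.eval (fun j => x j) (MvPolynomial.pderiv i (v m)) *
      MvPolynomial.eval (fun j => x j) D + c *
        (MvPolynomial.eval (fun j => x j) (MvPolynomial.pderiv i' (v m')) *
      MvPolynomial.eval (fun j => x j) D)) := by
        refine integral_congr_ae (.of_forall fun x => ?_)
        simp only
        conv_lhs => enter [1]; rw [hD]
        simp only [map_add, map_mul, MvPolynomial.eval_C]
        ring
    _ = 0 := by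
        rw [integral_add (hint _ _) ((hint _ _).const_mul c), integral_const_mul, h1, h2]
        simp

end NonconformingFE

/-! ### Complex polynomials orthogonal to powers along two sides of a triangle. -/

namespace NonconformingFE
open Module Measure

section LineIntegrals

open Polynomial

theorem exists_antiderivative (Q : ℂ[X]) (a : ℂ) :
    ∃ P : ℂ[X], derivative P = Q ∧ P.eval a = 0 ∧ P.natDegree ≤ Q.natDegree + 1 := by
  let R : ℂ[X] := ∑ n ∈ Finset.range (Q.natDegree + 1), monomial (n + 1) (Q.coeff n / (n + 1))
  have hR : derivative R = Q := by
    conv_rhs => rw [Q.as_sum_range]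
    simp only [R, derivative_sum, derivative_monomial, Nat.add_sub_cancel]
    refine Finset.sum_congr rfl fun n _ => ?_
    rw [Nat.cast_add, Nat.cast_one, div_mul_cancel₀ _ (Nat.cast_add_one_ne_zero n)]
  refine ⟨R - C (R.eval a), by simp [hR], by simp, ?_⟩
  rw [natDegree_sub_C]
  refine natDegree_sum_le_of_forall_le _ _ fun n hn => (natDegree_monomial_le _).trans ?_
  exact Nat.add_le_add_right (Nat.lt_succ_iff.1 (Finset.mem_range.1 hn)) 1

/-- The mean value of a complex polynomial along the segment from `a` to `b`. -/
noncomputable def segmentIntegral (a b : ℂ) (Q : ℂ[X]) : ℂ :=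
  ∫ t in (0 : ℝ)..1, Q.eval (a + t * (b - a))

theorem continuous_eval_segment (a b : ℂ) (Q : ℂ[X]) :
    Continuous fun t : ℝ => Q.eval (a + t * (b - a)) :=
  Q.continuous.comp (by fun_prop)

theorem segmentIntegral_sub (a b : ℂ) (P Q : ℂ[X]) :
    segmentIntegral a b (P - Q) = segmentIntegral a b P - segmentIntegral a b Q := by
  simp only [segmentIntegral, eval_sub]
  exact intervalIntegral.integral_sub ((continuous_eval_segment a b P).intervalIntegrable _ _)
    ((continuous_eval_segment a b Q).intervalIntegrable _ _)

theorem segmentIntegral_C_mul (a b c : ℂ) (Q : ℂ[X]) :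
    segmentIntegral a b (C c * Q) = c * segmentIntegral a b Q := by
  simp [segmentIntegral]

theorem mul_segmentIntegral_derivative (a b : ℂ) (P : ℂ[X]) :
    (b - a) * segmentIntegral a b (derivative P) = P.eval b - P.eval a := by
  have h : ∀ t : ℝ, HasDerivAt (fun t : ℝ => P.eval (a + t * (b - a)))
      ((b - a) * (derivative P).eval (a + t * (b - a))) t := by
    intro t
    have h1 : HasDerivAt (fun t : ℝ => a + (t : ℂ) * (b - a)) (b - a) t := by
      simpa using ((Complex.ofRealCLM.hasDerivAt (x := t)).mul_const (b - a)).const_add a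
    exact ((P.hasDerivAt _).comp t h1).congr_deriv (mul_comm _ _)
  have h2 := intervalIntegral.integral_eq_sub_of_hasDerivAt (fun t _ => h t)
    ((continuous_const.mul (continuous_eval_segment a b (derivative P))).intervalIntegrable 0 1)
  rw [intervalIntegral.integral_const_mul] at h2
  simpa [segmentIntegral] using h2

/-- Orthogonality to low powers passes to the antiderivative. -/
theorem segmentIntegral_antiderivative {k : ℕ} {a b : ℂ} (hab : a ≠ b) {Q P : ℂ[X]}
    (hP : derivative P = Q) (ha : P.eval a = 0)
    (h : ∀ j < k + 1, segmentIntegral a b (Q * X ^ j) = 0) :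
    P.eval b = 0 ∧ ∀ j < k, segmentIntegral a b (P * X ^ j) = 0 := by
  -- The case `j = 0` of the hypothesis: `P(b) - P(a)` is `b - a` times the mean value of `Q`.
  have hb : P.eval b = 0 := by
    have h1 := mul_segmentIntegral_derivative a b P
    have h2 := h 0 (Nat.succ_pos k)
    rw [pow_zero, mul_one] at h2
    rw [hP, h2, ha] at h1
    simpa using h1.symm
  refine ⟨hb, fun j hj => ?_⟩
  have h1 := mul_segmentIntegral_derivative a b (P * X ^ (j + 1))
  -- Integration by parts: `P` vanishes at both ends, so the derivative integrates to zero, and the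
  -- moment of `P` of order `j` reduces to that of `Q` of order `j + 1`.
  have h2 : C ((j : ℂ) + 1) * (P * X ^ j) = derivative (P * X ^ (j + 1)) - Q * X ^ (j + 1) := by
    simp only [derivative_mul, hP, derivative_X_pow, Nat.cast_add, Nat.cast_one,
      Nat.add_sub_cancel, map_add, map_one, map_natCast]
    ring
  have h3 : segmentIntegral a b (derivative (P * X ^ (j + 1))) = 0 := by
    simpa [ha, hb, sub_eq_zero, hab.symm] using h1
  have h4 := congrArg (segmentIntegral a b) h2
  rw [segmentIntegral_C_mul, segmentIntegral_sub, h3, h (j + 1) (by omega), sub_zero] at h4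
  exact (mul_eq_zero.1 h4).resolve_left (Nat.cast_add_one_ne_zero j)

/-- The two segments share the endpoint `a`, so a single antiderivative normalized at `a` serves
both. Each integration uses up one moment condition per segment and produces zeros at `b` and `c`.
-/
theorem exists_iterated_antiderivative {a b c : ℂ} (hab : a ≠ b) (hac : a ≠ c) (k : ℕ) :
    ∀ Q : ℂ[X], (∀ j < k, segmentIntegral a b (Q * X ^ j) = 0) →
      (∀ j < k, segmentIntegral a c (Q * X ^ j) = 0) →
      ∃ R : ℂ[X], derivative^[k] R = Q ∧ R.natDegree ≤ Q.natDegree + k ∧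
        ∀ i < k, (derivative^[i] R).eval a = 0 ∧ (derivative^[i] R).eval b = 0 ∧
          (derivative^[i] R).eval c = 0 := by
  induction k with
  | zero => exact fun Q _ _ => ⟨Q, rfl, le_rfl, fun i hi => absurd hi (Nat.not_lt_zero i)⟩
  | succ k ih =>
    intro Q hb hc
    obtain ⟨P, hP, ha, hdeg⟩ := exists_antiderivative Q a
    obtain ⟨hPb, hb'⟩ := segmentIntegral_antiderivative hab hP ha hb
    obtain ⟨hPc, hc'⟩ := segmentIntegral_antiderivative hac hP ha hc
    obtain ⟨R, hR, hRdeg, hRv⟩ := ih P hb' hc'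
    refine ⟨R, by rw [Function.iterate_succ_apply', hR, hP], by omega, fun i hi => ?_⟩
    rcases Nat.lt_succ_iff_lt_or_eq.1 hi with h | rfl
    · exact hRv i h
    · rw [hR]; exact ⟨ha, hPb, hPc⟩

theorem X_sub_C_pow_dvd_of_iterate_derivative {R : ℂ[X]} {k : ℕ} {a : ℂ}
    (h : ∀ i < k, (derivative^[i] R).eval a = 0) : (X - C a) ^ k ∣ R := by
  rcases eq_or_ne R 0 with rfl | hR
  · exact dvd_zero _
  rcases k with _ | k
  · simp
  · rw [← le_rootMultiplicity_iff hR, Nat.succ_le_iff,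
      lt_rootMultiplicity_iff_isRoot_iterate_derivative hR]
    exact fun m hm => h m (Nat.lt_succ_of_le hm)

/-- A polynomial of degree less than `2 k` which is orthogonal to the polynomials of degree less
than `k` along two sides of a nondegenerate triangle is zero. -/
theorem eq_zero_of_segmentIntegral_eq_zero {a b c : ℂ} (hab : a ≠ b) (hac : a ≠ c) (hbc : b ≠ c)
    {k : ℕ} {Q : ℂ[X]} (hdeg : Q.natDegree < 2 * k)
    (hb : ∀ j < k, segmentIntegral a b (Q * X ^ j) = 0)
    (hc : ∀ j < k, segmentIntegral a c (Q * X ^ j) = 0) : Q = 0 := by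
  obtain ⟨R, hR, hRdeg, hRv⟩ := exists_iterated_antiderivative hab hac k Q hb hc
  have h1 := X_sub_C_pow_dvd_of_iterate_derivative fun i hi => (hRv i hi).1
  have h2 := X_sub_C_pow_dvd_of_iterate_derivative fun i hi => (hRv i hi).2.1
  have h3 := X_sub_C_pow_dvd_of_iterate_derivative fun i hi => (hRv i hi).2.2
  have cop : ∀ {x y : ℂ}, x ≠ y → IsCoprime ((X - C x) ^ k) ((X - C y) ^ k) := fun hxy =>
    (isCoprime_X_sub_C_of_isUnit_sub (sub_ne_zero.2 hxy).isUnit).pow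
  have h := ((cop hac).mul_left (cop hbc)).mul_dvd ((cop hab).mul_dvd h1 h2) h3
  -- The product of the three coprime powers has degree `3k`, while `deg R ≤ deg Q + k < 3k`.
  have hR0 : R = 0 := by
    refine eq_zero_of_dvd_of_natDegree_lt h ?_
    rw [← mul_pow, ← mul_pow, natDegree_pow, natDegree_mul (mul_ne_zero (X_sub_C_ne_zero _)
      (X_sub_C_ne_zero _)) (X_sub_C_ne_zero _), natDegree_mul (X_sub_C_ne_zero _)
      (X_sub_C_ne_zero _)]
    simp only [natDegree_X_sub_C]
    omega
  rw [← hR, hR0, iterate_derivative_zero]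

end LineIntegrals

/-! ### Cauchy-Riemann equation for polynomials. -/

section Holomorphic

open MvPolynomial

/-- A polynomial annihilated by the Cauchy-Riemann operator is a polynomial in `x + i y`. -/
theorem eval_eq_of_cauchyRiemann {W : MvPolynomial (Fin 2) ℂ}
    (hW : pderiv 0 W + C Complex.I * pderiv 1 W = 0) (x y : ℂ) :
    eval ![x, y] W = eval ![x + Complex.I * y, 0] W := by
  -- This segment in `ℂ²` keeps `x + i y` constant. Its direction is `-i y` times `(1, i)`, so
  -- differentiating `W` along it gives a multiple of the Cauchy-Riemann operator.
  let γ : ℝ → Fin 2 → ℂ := fun t => ![x + Complex.I * ((1 - t) * y), t * y]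
  have hγ : ∀ (t : ℝ) (i : Fin 2), HasDerivAt (fun s => γ s i) (![-(Complex.I * y), y] i) t := by
    intro t i
    have h0 : HasDerivAt (fun s : ℝ => (s : ℂ)) 1 t := Complex.ofRealCLM.hasDerivAt (x := t)
    fin_cases i
    · exact ((((h0.const_sub 1).mul_const y).const_mul Complex.I).const_add x).congr_deriv
        (by simp)
    · exact (h0.mul_const y).congr_deriv (by simp)
  have hconst : ∀ t : ℝ, HasDerivAt (fun s => eval (γ s) W) 0 t := by
    intro t
    refine (hasDerivAt_eval W (hγ t)).congr_deriv ?_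
    have h1 := congrArg (eval (γ t)) hW
    simp only [map_add, map_mul, eval_C, map_zero] at h1
    rw [Fin.sum_univ_two]
    simp only [Matrix.cons_val_zero, Matrix.cons_val_one]
    linear_combination (-(Complex.I * y)) * h1 +
      (eval (γ t) (pderiv 1 W)) * y * Complex.I_mul_I
  have := is_const_of_deriv_eq_zero (fun t => (hconst t).differentiableAt)
    (fun t => (hconst t).deriv) 1 0
  simpa [γ] using this

theorem exists_polynomial_of_cauchyRiemann {W : MvPolynomial (Fin 2) ℂ}
    (hW : pderiv 0 W + C Complex.I * pderiv 1 W = 0) :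
    ∃ Q : Polynomial ℂ, Q.natDegree ≤ W.totalDegree ∧
      ∀ x y : ℂ, eval ![x, y] W = Q.eval (x + Complex.I * y) := by
  refine ⟨aeval ![Polynomial.X, 0] W, ?_, fun x y => ?_⟩
  · refine (aeval_natDegree_le W le_rfl _ (n := 1) fun i => ?_).trans (mul_one _).le
    fin_cases i <;> simp
  · rw [eval_eq_of_cauchyRiemann hW]
    have h := comp_aeval_apply (R := ℂ) (![Polynomial.X, 0] : Fin 2 → Polynomial ℂ)
      (Polynomial.aeval (x + Complex.I * y)) W
    have h2 : (fun i => Polynomial.aeval (x + Complex.I * y)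
        ((![Polynomial.X, 0] : Fin 2 → Polynomial ℂ) i)) = ![x + Complex.I * y, 0] := by
      funext i
      fin_cases i <;> simp
    rw [h2] at h
    rw [← Polynomial.coe_aeval_eq_eval, h, ← coe_aeval_eq_eval]
    rfl

end Holomorphic

end NonconformingFE

/-! ### Uniqueness in dimension two. -/

namespace NonconformingFE
open Module Measure
open MvPolynomial (X C eval pderiv)

theorem pderiv_comm {σ R : Type*} [CommSemiring R] (i j : σ) (f : MvPolynomial σ R) :
    pderiv i (pderiv j f) = pderiv j (pderiv i f) := by
  classical
  ext m
  simp only [MvPolynomial.coeff_pderiv]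
  rw [add_right_comm m]
  by_cases h : i = j
  · rw [h]
  · simp [h, Ne.symm h]
    ring

theorem laplacian_apply (d : ℕ) (f : MvPolynomial (Fin d) ℝ) :
    laplacian d f = ∑ i, pderiv i (pderiv i f) := by
  simp [laplacian]

theorem polyGradient_apply (d : ℕ) (f : MvPolynomial (Fin d) ℝ) (i : Fin d) :
    polyGradient d f i = pderiv i f := rfl

/-- Divergence- and curl-free fields of degree at most `n`. -/
def harmonicFields (n : ℕ) : Submodule ℝ (VField 2) where
  carrier := {v | (∀ m, (v m).totalDegree ≤ n) ∧ pderiv 0 (v 0) + pderiv 1 (v 1) = 0 ∧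
    pderiv 0 (v 1) - pderiv 1 (v 0) = 0}
  add_mem' := by
    rintro v w ⟨h1, h2, h3⟩ ⟨h1', h2', h3'⟩
    refine ⟨fun m => (MvPolynomial.totalDegree_add _ _).trans (max_le (h1 m) (h1' m)), ?_, ?_⟩
    · simp only [Pi.add_apply, map_add]
      linear_combination h2 + h2'
    · simp only [Pi.add_apply, map_add]
      linear_combination h3 + h3'
  zero_mem' := by simp
  smul_mem' := by
    rintro c v ⟨h1, h2, h3⟩
    refine ⟨fun m => (MvPolynomial.totalDegree_smul_le _ _).trans (h1 m), ?_, ?_⟩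
    · simp only [Pi.smul_apply, Derivation.map_smul, ← smul_add, h2, smul_zero]
    · simp only [Pi.smul_apply, Derivation.map_smul, ← smul_sub, h3, smul_zero]

theorem map_polyGradient_le_harmonicFields {m n : ℕ} (h : m ≤ n + 1) :
    (harmonicHomogeneous 2 m).map (polyGradient 2) ≤ harmonicFields n := by
  rintro _ ⟨f, ⟨hf, hf'⟩, rfl⟩
  rw [SetLike.mem_coe, LinearMap.mem_ker, laplacian_apply, Fin.sum_univ_two] at hf'
  rw [SetLike.mem_coe, MvPolynomial.mem_homogeneousSubmodule] at hf
  refine ⟨fun i => ?_, hf', ?_⟩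
  · have := (hf.pderiv (i := i)).totalDegree_le
    rw [polyGradient_apply]
    omega
  · simp only [polyGradient_apply]
    rw [pderiv_comm, sub_self]

/-- The harmonic gradients raise the degree of the field up to `2k - 1` but are invisible to
divergence and curl, which see only the part of degree at most `k`. -/
theorem totalDegree_of_mem_fieldSpace_two {k : ℕ} (hk : 1 ≤ k) {v : VField 2}
    (hv : v ∈ fieldSpace k 2) :
    (∀ m, (v m).totalDegree < 2 * k) ∧
      (pderiv 0 (v 0) + C 1 * pderiv 1 (v 1)).totalDegree + 1 ≤ k ∧
      (pderiv 0 (v 1) + C (-1) * pderiv 1 (v 0)).totalDegree + 1 ≤ k := by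
  obtain ⟨p, hp, h, hh, rfl⟩ := Submodule.mem_sup.1 hv
  have hle : (⨆ m ∈ Finset.Icc (k + 2) (2 * k),
      (harmonicHomogeneous 2 m).map (polyGradient 2)) ≤ harmonicFields (2 * k - 1) :=
    iSup₂_le fun m hm => map_polyGradient_le_harmonicFields (by
      have := (Finset.mem_Icc.1 hm).2; omega)
  obtain ⟨h1, h2, h3⟩ := hle hh
  have hp' : ∀ m, (p m).totalDegree ≤ k := fun m =>
    (MvPolynomial.mem_restrictTotalDegree _ _ _).1 (hp m (Set.mem_univ m))
  have hpd : ∀ i m, (pderiv i (p m)).totalDegree ≤ k - 1 := fun i m =>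
    totalDegree_pderiv_le i (hp' m)
  have hC : ∀ (c : ℝ) i m, (C c * pderiv i (p m)).totalDegree ≤ k - 1 := fun c i m =>
    (MvPolynomial.totalDegree_mul _ _).trans (by simpa using hpd i m)
  refine ⟨fun m => ?_, ?_, ?_⟩
  · have h4 : max k (2 * k - 1) < 2 * k := by omega
    exact lt_of_le_of_lt ((MvPolynomial.totalDegree_add (p m) (h m)).trans
      (max_le_max (hp' m) (h1 m))) h4
  · have : pderiv 0 ((p + h) 0) + C 1 * pderiv 1 ((p + h) 1) =
        pderiv 0 (p 0) + C 1 * pderiv 1 (p 1) := by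
      simp only [Pi.add_apply, map_add, map_one, one_mul]
      linear_combination h2
    rw [this]
    have := (MvPolynomial.totalDegree_add (pderiv 0 (p 0)) (C 1 * pderiv 1 (p 1))).trans
      (max_le (hpd 0 0) (hC 1 1 1))
    omega
  · have : pderiv 0 ((p + h) 1) + C (-1) * pderiv 1 ((p + h) 0) =
        pderiv 0 (p 1) + C (-1) * pderiv 1 (p 0) := by
      simp only [Pi.add_apply, map_add, map_one, map_neg]
      linear_combination h3
    rw [this]
    have := (MvPolynomial.totalDegree_add (pderiv 0 (p 1)) (C (-1) * pderiv 1 (p 0))).trans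
      (max_le (hpd 0 1) (hC (-1) 1 0))
    omega

/-- The real and imaginary parts of `(x + i y) ^ n` as polynomials in `x` and `y`. -/
noncomputable def reImPow : ℕ → MvPolynomial (Fin 2) ℝ × MvPolynomial (Fin 2) ℝ
  | 0 => (1, 0)
  | n + 1 => (X 0 * (reImPow n).1 - X 1 * (reImPow n).2, X 0 * (reImPow n).2 + X 1 * (reImPow n).1)

theorem isHomogeneous_reImPow (n : ℕ) :
    (reImPow n).1.IsHomogeneous n ∧ (reImPow n).2.IsHomogeneous n := by
  induction n with
  | zero => exact ⟨MvPolynomial.isHomogeneous_one _ _, MvPolynomial.isHomogeneous_zero _ _ _⟩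
  | succ n ih =>
    have hX : ∀ i : Fin 2, (X i : MvPolynomial (Fin 2) ℝ).IsHomogeneous 1 :=
      MvPolynomial.isHomogeneous_X ℝ
    rw [reImPow, add_comm n 1]
    exact ⟨(((hX 0).mul ih.1).sub ((hX 1).mul ih.2)), (((hX 0).mul ih.2).add ((hX 1).mul ih.1))⟩

theorem eval_reImPow (n : ℕ) (x : Fin 2 → ℝ) :
    ((eval x (reImPow n).1 : ℝ) : ℂ) + Complex.I * (eval x (reImPow n).2 : ℝ) =
      ((x 0 : ℂ) + Complex.I * x 1) ^ n := by
  induction n with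
  | zero => simp [reImPow]
  | succ n ih =>
    rw [pow_succ, ← ih]
    simp only [reImPow, map_sub, map_add, map_mul, MvPolynomial.eval_X]
    push_cast
    linear_combination (-(x 1 : ℂ) * (eval x (reImPow n).2 : ℝ)) * Complex.I_mul_I

theorem pderiv_reImPow (n : ℕ) :
    pderiv 0 (reImPow (n + 1)).1 = C ((n : ℝ) + 1) * (reImPow n).1 ∧
    pderiv 1 (reImPow (n + 1)).1 = - (C ((n : ℝ) + 1) * (reImPow n).2) ∧
    pderiv 0 (reImPow (n + 1)).2 = C ((n : ℝ) + 1) * (reImPow n).2 ∧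
    pderiv 1 (reImPow (n + 1)).2 = C ((n : ℝ) + 1) * (reImPow n).1 := by
  induction n with
  | zero => simp [reImPow]
  | succ n ih =>
    obtain ⟨h1, h2, h3, h4⟩ := ih
    rw [reImPow]
    simp only [map_sub, map_add, Derivation.leibniz, smul_eq_mul, h1, h2, h3, h4,
      MvPolynomial.pderiv_X_self, MvPolynomial.pderiv_X_of_ne (zero_ne_one' (Fin 2)),
      MvPolynomial.pderiv_X_of_ne (zero_ne_one' (Fin 2)).symm, Nat.cast_add, Nat.cast_one, map_one]
    simp only [reImPow]
    refine ⟨?_, ?_, ?_, ?_⟩ <;> ring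

theorem reImPow_mem_harmonicHomogeneous (n : ℕ) :
    (reImPow n).1 ∈ harmonicHomogeneous 2 n ∧ (reImPow n).2 ∈ harmonicHomogeneous 2 n := by
  have h : laplacian 2 (reImPow n).1 = 0 ∧ laplacian 2 (reImPow n).2 = 0 := by
    simp only [laplacian_apply, Fin.sum_univ_two]
    rcases n with _ | _ | n
    · simp [reImPow]
    · simp [reImPow]
    · have h := pderiv_reImPow (n + 1)
      have h' := pderiv_reImPow n
      simp only [h, h', map_neg, MvPolynomial.pderiv_C_mul]
      constructor <;> ring
  exact ⟨⟨(isHomogeneous_reImPow n).1, h.1⟩, ⟨(isHomogeneous_reImPow n).2, h.2⟩⟩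

/-- The identification of the Euclidean plane with the complex numbers. -/
noncomputable def toComplex (x : Space 2) : ℂ := (x 0 : ℂ) + Complex.I * x 1

theorem toComplex_injective : Function.Injective toComplex := by
  intro x y h
  have h0 := congrArg Complex.re h
  have h1 := congrArg Complex.im h
  simp [toComplex] at h0 h1
  ext i
  fin_cases i
  · exact h0
  · exact h1

theorem toComplex_edgeMap (T : Simplex 2) (p q : Fin 3) (t : ℝ) :
    toComplex (T.edgeMap p q t) =
      toComplex (T p) + t * (toComplex (T q) - toComplex (T p)) := by
  simp only [toComplex, Simplex.edgeMap_apply, PiLp.add_apply, PiLp.smul_apply, PiLp.sub_apply,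
    smul_eq_mul]
  push_cast
  ring

/-- With `z^j = A + i B`, the product `(v_0 - i v_1)(A + i B)` splits into four real products of a
component with a weight of degree `j ≤ k - 1`, each of which is an edge moment. -/
theorem VanishingMoments.segmentIntegral_eq_zero {k : ℕ} {T : Simplex 2} {v : VField 2}
    (h : VanishingMoments k T v) {Q : Polynomial ℂ}
    (hQ : ∀ x : Space 2, Q.eval (toComplex x) =
      (eval (fun j => x j) (v 0) : ℝ) - Complex.I * (eval (fun j => x j) (v 1) : ℝ))
    {p q : Fin 3} (hpq : p ≠ q) (j : ℕ) (hj : j < k) :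
    segmentIntegral (toComplex (T p)) (toComplex (T q)) (Q * Polynomial.X ^ j) = 0 := by
  obtain ⟨l, hpl, hql⟩ : ∃ l : Fin 3, p ≠ l ∧ q ≠ l := by decide +revert
  obtain ⟨c, hc, hI⟩ := T.exists_integral_facet_two hpq hpl hql
  have hcont : ∀ g : MvPolynomial (Fin 2) ℝ,
      Continuous fun t => eval (fun j => T.edgeMap p q t j) g := fun g =>
    (continuous_eval_space g).comp (T.edgeMap p q).continuous_of_finiteDimensional
  have hzero : ∀ (g : MvPolynomial (Fin 2) ℝ) (m : Fin 2), g.IsHomogeneous j →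
      ∫ t in (0 : ℝ)..1, ((eval (fun j => T.edgeMap p q t j) g *
        eval (fun j => T.edgeMap p q t j) (v m) : ℝ) : ℂ) = 0 := by
    intro g m hg
    have h1 := h.facet l m g (by have := hg.totalDegree_le; omega)
    rw [hI] at h1
    rw [intervalIntegral.integral_ofReal, (mul_eq_zero.1 h1).resolve_left hc, Complex.ofReal_zero]
  obtain ⟨hA, hB⟩ := isHomogeneous_reImPow j
  have hint : ∀ (g : MvPolynomial (Fin 2) ℝ) (m : Fin 2), IntervalIntegrable
      (fun t => ((eval (fun j => T.edgeMap p q t j) g *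
        eval (fun j => T.edgeMap p q t j) (v m) : ℝ) : ℂ)) volume 0 1 := fun g m =>
    (Complex.continuous_ofReal.comp ((hcont g).mul (hcont (v m)))).intervalIntegrable _ _
  have key : ∀ t : ℝ, (Q * Polynomial.X ^ j).eval
      (toComplex (T p) + t * (toComplex (T q) - toComplex (T p))) =
      (((eval (fun j => T.edgeMap p q t j) (reImPow j).1 *
        eval (fun j => T.edgeMap p q t j) (v 0) : ℝ) : ℂ) +
      ((eval (fun j => T.edgeMap p q t j) (reImPow j).2 *
        eval (fun j => T.edgeMap p q t j) (v 1) : ℝ) : ℂ)) +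
      Complex.I * (((eval (fun j => T.edgeMap p q t j) (reImPow j).2 *
        eval (fun j => T.edgeMap p q t j) (v 0) : ℝ) : ℂ) -
      ((eval (fun j => T.edgeMap p q t j) (reImPow j).1 *
        eval (fun j => T.edgeMap p q t j) (v 1) : ℝ) : ℂ)) := by
    intro t
    rw [← toComplex_edgeMap, Polynomial.eval_mul, Polynomial.eval_pow, Polynomial.eval_X, hQ]
    have := eval_reImPow j (fun j => T.edgeMap p q t j)
    rw [toComplex, ← this]
    push_cast
    linear_combination (-((eval (fun j => T.edgeMap p q t j) (v 1) : ℝ) : ℂ) *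
      ((eval (fun j => T.edgeMap p q t j) (reImPow j).2 : ℝ) : ℂ)) * Complex.I_mul_I
  simp only [segmentIntegral, key]
  rw [intervalIntegral.integral_add ((hint _ _).add (hint _ _))
      (((hint _ _).sub (hint _ _)).const_mul _),
    intervalIntegral.integral_add (hint _ _) (hint _ _), intervalIntegral.integral_const_mul,
    intervalIntegral.integral_sub (hint _ _) (hint _ _), hzero _ _ hA, hzero _ _ hA,
    hzero _ _ hB, hzero _ _ hB]
  simp

theorem VanishingMoments.eq_zero {k : ℕ} (hk : 1 ≤ k) {T : Simplex 2} {v : VField 2}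
    (h : VanishingMoments k T v) (hv : v ∈ fieldSpace k 2) : v = 0 := by
  obtain ⟨hdeg, hdiv, hcurl⟩ := totalDegree_of_mem_fieldSpace_two hk hv
  have hdiv := h.pderiv_combination_eq_zero 0 0 1 1 1 hdiv
  have hcurl := h.pderiv_combination_eq_zero 0 1 1 0 (-1) hcurl
  -- The conjugate field is the holomorphic one: `(∂_0 + i ∂_1)(v_0 - i v_1) = div v - i curl v`.
  let W : MvPolynomial (Fin 2) ℂ := MvPolynomial.map (algebraMap ℝ ℂ) (v 0) -
    C Complex.I * MvPolynomial.map (algebraMap ℝ ℂ) (v 1)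
  have hW : pderiv 0 W + C Complex.I * pderiv 1 W = 0 := by
    have h1 := congrArg (MvPolynomial.map (algebraMap ℝ ℂ)) hdiv
    have h2 := congrArg (MvPolynomial.map (algebraMap ℝ ℂ)) hcurl
    have h3 : (C Complex.I * C Complex.I : MvPolynomial (Fin 2) ℂ) = -1 := by
      rw [← map_mul, Complex.I_mul_I]; simp
    simp only [map_add, map_mul, map_one, map_zero, one_mul, map_neg] at h1 h2
    simp only [W, map_sub, MvPolynomial.pderiv_C_mul, MvPolynomial.pderiv_map]
    linear_combination h1 - C Complex.I * h2 -
      MvPolynomial.map (algebraMap ℝ ℂ) (pderiv 1 (v 1)) * h3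
  obtain ⟨Q, hQdeg, hQ⟩ := exists_polynomial_of_cauchyRiemann hW
  have hQ' : ∀ x : Fin 2 → ℝ, Q.eval ((x 0 : ℂ) + Complex.I * x 1) =
      (eval x (v 0) : ℝ) - Complex.I * (eval x (v 1) : ℝ) := by
    intro x
    have h1 : ∀ g : MvPolynomial (Fin 2) ℝ, eval ![(x 0 : ℂ), (x 1 : ℂ)]
        (MvPolynomial.map (algebraMap ℝ ℂ) g) = (eval x g : ℝ) := by
      intro g
      have h2 : ![(x 0 : ℂ), (x 1 : ℂ)] = algebraMap ℝ ℂ ∘ x := by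
        funext i; fin_cases i <;> rfl
      rw [h2, MvPolynomial.eval_map, ← MvPolynomial.eval₂_comp]
      rfl
    rw [← hQ, map_sub, map_mul, h1, h1, MvPolynomial.eval_C]
  have hWdeg : Q.natDegree < 2 * k := by
    refine lt_of_le_of_lt hQdeg (lt_of_le_of_lt (MvPolynomial.totalDegree_sub _ _) (max_lt ?_ ?_))
    · exact lt_of_le_of_lt (Finset.sup_mono (MvPolynomial.support_map_subset _ _)) (hdeg 0)
    · refine lt_of_le_of_lt (MvPolynomial.totalDegree_mul _ _) ?_
      rw [MvPolynomial.totalDegree_C, zero_add]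
      exact lt_of_le_of_lt (Finset.sup_mono (MvPolynomial.support_map_subset _ _)) (hdeg 1)
  have hinj : ∀ {p q : Fin 3}, p ≠ q → toComplex (T p) ≠ toComplex (T q) := fun hpq =>
    toComplex_injective.ne (T.ind.injective.ne hpq)
  have hQ0 : Q = 0 :=
    eq_zero_of_segmentIntegral_eq_zero (hinj (p := 0) (q := 1) (by decide))
      (hinj (p := 0) (q := 2) (by decide)) (hinj (p := 1) (q := 2) (by decide)) hWdeg
      (h.segmentIntegral_eq_zero (fun x => hQ' x) (by decide))
      (h.segmentIntegral_eq_zero (fun x => hQ' x) (by decide))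
  have hre : ∀ x, eval x (v 0) = 0 ∧ eval x (v 1) = 0 := by
    intro x
    have := hQ' x
    rw [hQ0, Polynomial.eval_zero] at this
    have h0 := congrArg Complex.re this
    have h1 := congrArg Complex.im this
    simp at h0 h1
    exact ⟨h0.symm, h1⟩
  funext m
  refine MvPolynomial.funext fun x => ?_
  fin_cases m
  · simpa using (hre x).1
  · simpa using (hre x).2

end NonconformingFE

/-! ### Linearity of the moments and dimension count in dimension two. -/

namespace NonconformingFE
open Module Measure
open MvPolynomial (X C eval pderiv)

theorem continuous_value {d : ℕ} (v : VField d) : Continuous v.value :=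
  (PiLp.continuous_toLp 2 _).comp (continuous_pi fun i => continuous_eval_space (v i))

theorem value_add {d : ℕ} (v w : VField d) (x : Space d) :
    VField.value (v + w) x = v.value x + w.value x := by
  ext i; simp [VField.value]

theorem value_smul {d : ℕ} (c : ℝ) (v : VField d) (x : Space d) :
    VField.value (c • v) x = c • v.value x := by
  ext i; simp [VField.value]

/-- Weighted integration of a component as a linear functional on polynomial fields. -/
theorem isLinearMap_integral_mul_inner_value {d : ℕ} {F : Set (Space d)} (hF : IsCompact F)
    {ν : Measure (Space d)} (hν : ν F ≠ ⊤) {f : Space d → ℝ} (hf : Continuous f) (y : Space d) :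
    IsLinearMap ℝ fun v : VField d => ∫ x in F, f x * inner ℝ (v.value x) y ∂ν where
  map_add v w := by
    have hint : ∀ v : VField d, IntegrableOn (fun x => f x * inner ℝ (v.value x) y) F ν := fun v =>
      integrableOn_of_continuous hF hν (hf.mul ((continuous_value v).inner continuous_const))
    simp only [value_add, inner_add_left, mul_add]
    exact integral_add (hint v) (hint w)
  map_smul c v := by
    simp only [value_smul, real_inner_smul_left, smul_eq_mul]
    rw [← integral_const_mul]
    exact integral_congr_ae (.of_forall fun x => mul_left_comm _ _ _)

theorem isLinearMap_moment {k d : ℕ} (T : Simplex d) (hT : ∀ j, μHE[d - 1] (T.facet j) ≠ ⊤)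
    (e : Basis (Fin d) ℝ (Space d)) (ι : InteriorIndex k d ⊕ FacetIndex k d) :
    IsLinearMap ℝ (moment T e ι) := by
  rcases ι with ⟨i, α⟩ | ⟨i, j, β⟩
  · exact isLinearMap_integral_mul_inner_value T.isCompact_body
      T.isCompact_body.measure_lt_top.ne (T.continuous_baryMonomial _) _
  · exact isLinearMap_integral_mul_inner_value (T.isCompact_facet j) (hT j)
      (T.continuous_baryMonomial _) _

/-- All moments together, as a linear map on the finite element space. -/
noncomputable def momentMap (k : ℕ) {d : ℕ} (T : Simplex d) (hT : ∀ j, μHE[d - 1] (T.facet j) ≠ ⊤)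
    (e : Basis (Fin d) ℝ (Space d)) :
    fieldSpace k d →ₗ[ℝ] (InteriorIndex k d ⊕ FacetIndex k d → ℝ) :=
  LinearMap.pi fun ι => (isLinearMap_moment T hT e ι).mk' _ ∘ₗ (fieldSpace k d).subtype

section Counting

/-- Pairs `(i, j)` with `j ≤ i < n`. -/
def staircase (n : ℕ) : Finset (Σ _ : ℕ, ℕ) := (Finset.range n).sigma fun i => Finset.range (i + 1)

theorem mem_staircase {n : ℕ} {x : Σ _ : ℕ, ℕ} : x ∈ staircase n ↔ x.1 < n ∧ x.2 < x.1 + 1 := by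
  simp [staircase]

theorem card_staircase (n : ℕ) : (staircase n).card = ∑ i ∈ Finset.range n, (i + 1) := by
  simp [staircase]

/-- Encodes exponents by partial sums. Upper bounds on the number of functionals suffice, so no
bijections are needed here or for the facets. -/
theorem interiorExponent_injective (k : ℕ) : Function.Injective
    fun α : {α : Fin 3 → ℕ // ∑ l, α l + 2 = k} =>
      (⟨⟨α.1 0 + α.1 1, α.1 0⟩, mem_staircase.2 ⟨by
        have := α.2; rw [Fin.sum_univ_three] at this; simp only; omega, by simp only; omega⟩⟩ :
        staircase (k - 1)) := by
  rintro ⟨α, hα⟩ ⟨β, hβ⟩ h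
  rw [Fin.sum_univ_three] at hα hβ
  simp only [Subtype.mk.injEq, Sigma.mk.injEq, heq_eq_eq] at h
  refine Subtype.ext (funext fun i => ?_)
  fin_cases i <;> simp only [Fin.zero_eta, Fin.mk_one, Fin.reduceFinMk] <;> omega

/-- On an edge only two exponents are free and their sum is `k - 1`, so one of them, taken at the
cyclic successor `j + 1`, determines `β`. -/
theorem facetExponent_injective (k : ℕ) : Function.Injective
    fun β : (Σ j : Fin 3, {β : Fin 3 → ℕ // ∑ l, β l + 1 = k ∧ β j = 0}) =>
      ((β.1, ⟨β.2.1 (β.1 + 1), by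
        have := β.2.2.1
        have h2 := Finset.single_le_sum (f := β.2.1) (fun _ _ => Nat.zero_le _)
          (Finset.mem_univ (β.1 + 1))
        omega⟩) : Fin 3 × Fin k) := by
  rintro ⟨j, α, hα, hα0⟩ ⟨j', β, hβ, hβ0⟩ h
  rw [Fin.sum_univ_three] at hα hβ
  simp only [Prod.mk.injEq, Fin.mk.injEq] at h
  obtain ⟨rfl, h⟩ := h
  have : α = β := by
    funext i
    fin_cases j <;> fin_cases i <;> simp_all <;> omega
  subst this
  rfl

instance (k : ℕ) : Finite (InteriorIndex k 2) :=
  have := Finite.of_injective _ (interiorExponent_injective k)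
  inferInstanceAs (Finite (Fin 2 × {α : Fin 3 → ℕ // ∑ l, α l + 2 = k}))

instance (k : ℕ) : Finite (FacetIndex k 2) :=
  have := Finite.of_injective _ (facetExponent_injective k)
  inferInstanceAs (Finite (Fin 2 × (Σ j : Fin 3, {β : Fin 3 → ℕ // ∑ l, β l + 1 = k ∧ β j = 0})))

theorem card_interiorIndex_le (k : ℕ) :
    Nat.card (InteriorIndex k 2) ≤ 2 * ∑ i ∈ Finset.range (k - 1), (i + 1) := by
  rw [Nat.card_prod, Nat.card_eq_fintype_card, Fintype.card_fin]
  refine Nat.mul_le_mul_left 2 ((Nat.card_le_card_of_injective _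
    (interiorExponent_injective k)).trans_eq ?_)
  rw [Nat.card_eq_fintype_card, Fintype.card_coe, card_staircase]

theorem card_facetIndex_le (k : ℕ) : Nat.card (FacetIndex k 2) ≤ 2 * (3 * k) := by
  rw [Nat.card_prod, Nat.card_eq_fintype_card, Fintype.card_fin]
  refine Nat.mul_le_mul_left 2 ((Nat.card_le_card_of_injective _
    (facetExponent_injective k)).trans_eq ?_)
  simp

theorem le_finrank_restrictTotalDegree (k : ℕ) :
    ∑ i ∈ Finset.range (k + 1), (i + 1) ≤
      finrank ℝ (MvPolynomial.restrictTotalDegree (Fin 2) ℝ k) := by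
  let s : Set (Fin 2 →₀ ℕ) := {n | (n.sum fun _ e => e) ≤ k}
  let b : Basis s ℝ (MvPolynomial.restrictTotalDegree (Fin 2) ℝ k) :=
    MvPolynomial.basisRestrictSupport ℝ s
  have : Finite s := Module.Finite.finite_basis b
  rw [finrank_eq_nat_card_basis b, ← card_staircase, ← Fintype.card_coe,
    ← Nat.card_eq_fintype_card]
  have hsum : ∀ f : Fin 2 →₀ ℕ, (f.sum fun _ e => e) = f 0 + f 1 := fun f => by
    rw [Finsupp.sum_fintype _ _ (fun _ => rfl), Fin.sum_univ_two]
  refine Nat.card_le_card_of_injective (fun x : staircase (k + 1) =>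
    (⟨Finsupp.equivFunOnFinite.symm ![x.1.2, x.1.1 - x.1.2], ?_⟩ : s)) ?_
  · have := mem_staircase.1 x.2
    change (Finsupp.sum _ _) ≤ k
    rw [hsum]
    simp
    omega
  · rintro ⟨⟨i, j⟩, hx⟩ ⟨⟨i', j'⟩, hx'⟩ h
    have h1 := congrArg (fun f : s => f.1 0) h
    have h2 := congrArg (fun f : s => f.1 1) h
    have h3 := mem_staircase.1 hx
    have h4 := mem_staircase.1 hx'
    simp at h1 h2 h3 h4
    have : i = i' := by omega
    subst this; subst h1; rfl

end Counting

/-- Gradients of the standard harmonic polynomials of degrees `k + 2, …, 2 k`. -/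
noncomputable def harmonicGradient (k : ℕ) (x : Fin (k - 1) × Fin 2) : VField 2 :=
  polyGradient 2 (![(reImPow (k + 1 + x.1 + 1)).1, (reImPow (k + 1 + x.1 + 1)).2] x.2)

theorem harmonicGradient_mem (k : ℕ) (x : Fin (k - 1) × Fin 2) :
    harmonicGradient k x ∈ fieldSpace k 2 := by
  obtain ⟨j, s⟩ := x
  have hj := j.2
  have hm : k + 1 + (j : ℕ) + 1 ∈ Finset.Icc (k + 2) (2 * k) := by
    rw [Finset.mem_Icc]; omega
  have hle : (harmonicHomogeneous 2 (k + 1 + (j : ℕ) + 1)).map (polyGradient 2) ≤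
      fieldSpace k 2 := le_sup_of_le_right (le_iSup₂_of_le _ hm le_rfl)
  refine hle (Submodule.mem_map_of_mem ?_)
  obtain ⟨h1, h2⟩ := reImPow_mem_harmonicHomogeneous (k + 1 + (j : ℕ) + 1)
  fin_cases s
  · exact h1
  · exact h2

theorem harmonicGradient_isHomogeneous (k : ℕ) (x : Fin (k - 1) × Fin 2) (i : Fin 2) :
    (harmonicGradient k x i).IsHomogeneous (k + 1 + x.1) := by
  obtain ⟨j, s⟩ := x
  obtain ⟨h1, h2⟩ := isHomogeneous_reImPow (k + 1 + (j : ℕ) + 1)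
  fin_cases s
  · exact h1.pderiv
  · exact h2.pderiv

/-- The sum of a field of degree at most `k` and a combination of harmonic gradients. -/
noncomputable def assembleField (k : ℕ) :
    (Fin 2 → MvPolynomial.restrictTotalDegree (Fin 2) ℝ k) × (Fin (k - 1) × Fin 2 → ℝ) →ₗ[ℝ]
      VField 2 :=
  LinearMap.coprod
    (LinearMap.pi fun i => (MvPolynomial.restrictTotalDegree (Fin 2) ℝ k).subtype ∘ₗ
      LinearMap.proj i)
    (Fintype.linearCombination ℝ (harmonicGradient k))

theorem assembleField_mem (k : ℕ) (x) : assembleField k x ∈ fieldSpace k 2 := by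
  rw [assembleField, LinearMap.coprod_apply]
  refine Submodule.add_mem _ ?_ ?_
  · refine le_sup_left (a := polyFields k 2) ?_
    exact fun i _ => (x.1 i).2
  · rw [Fintype.linearCombination_apply]
    exact Submodule.sum_mem _ fun j _ => Submodule.smul_mem _ _ (harmonicGradient_mem k j)

theorem eval_reImPow_one_zero (n : ℕ) :
    eval ![1, 0] (reImPow n).1 = 1 ∧ eval ![1, 0] (reImPow n).2 = 0 := by
  have h := eval_reImPow n ![1, 0]
  have h0 := congrArg Complex.re h
  have h1 := congrArg Complex.im h
  simp at h0 h1
  exact ⟨h0, h1⟩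

/-- The gradients are homogeneous of distinct degrees above `k`, except for the pair from the real
and imaginary parts of one power. At the point `(1, 0)` the gradients of such a pair are nonzero
multiples of `(1, 0)` and `(0, 1)`. -/
theorem assembleField_injective (k : ℕ) : Function.Injective (assembleField k) := by
  rw [injective_iff_map_eq_zero]
  rintro ⟨p, c⟩ h
  have hcomp : ∀ i, (p i : MvPolynomial (Fin 2) ℝ) + ∑ x, c x • harmonicGradient k x i = 0 := by
    intro i
    have := congrFun h i
    simpa [assembleField, Fintype.linearCombination_apply, Finset.sum_apply] using this
  have hc : ∀ j : Fin (k - 1), ∀ i,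
      c (j, 0) • harmonicGradient k (j, 0) i + c (j, 1) • harmonicGradient k (j, 1) i = 0 := by
    intro j i
    have h1 := congrArg (MvPolynomial.homogeneousComponent (k + 1 + (j : ℕ))) (hcomp i)
    have hp : ((p i : MvPolynomial (Fin 2) ℝ)).totalDegree < k + 1 + (j : ℕ) := by
      have := (MvPolynomial.mem_restrictTotalDegree _ _ _).1 (p i).2
      omega
    rw [map_add, MvPolynomial.homogeneousComponent_eq_zero _ _ hp, zero_add, map_zero,
      _root_.map_sum, Fintype.sum_prod_type, Finset.sum_eq_single j] at h1
    · rw [Fin.sum_univ_two] at h1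
      simpa only [map_smul, MvPolynomial.homogeneousComponent_of_mem
        (harmonicGradient_isHomogeneous k _ i), if_true] using h1
    · intro j' _ hj'
      have hne : ¬ (k + 1 + (j : ℕ) = k + 1 + (j' : ℕ)) := fun h => hj' (Fin.ext (by omega))
      simp only [map_smul, MvPolynomial.homogeneousComponent_of_mem
        (harmonicGradient_isHomogeneous k _ i), if_neg hne, smul_zero, Finset.sum_const_zero]
    · exact fun h => absurd (Finset.mem_univ j) h
  have hc0 : c = 0 := by
    funext ⟨j, s⟩
    obtain ⟨e1, e2⟩ := eval_reImPow_one_zero (k + 1 + (j : ℕ))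
    obtain ⟨d1, d2, d3, d4⟩ := pderiv_reImPow (k + 1 + (j : ℕ))
    have hpos : (((k + 1 + (j : ℕ) : ℕ) : ℝ) + 1) ≠ 0 := Nat.cast_add_one_ne_zero _
    have h0 := congrArg (eval ![1, 0]) (hc j 0)
    have h1 := congrArg (eval ![1, 0]) (hc j 1)
    simp only [harmonicGradient, polyGradient_apply, Matrix.cons_val_zero, Matrix.cons_val_one,
      d1, d2, d3, d4, map_add, MvPolynomial.smul_eval, map_mul, map_neg, MvPolynomial.eval_C,
      e1, e2, map_zero, mul_one, mul_zero, add_zero, neg_zero, zero_add] at h0 h1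
    fin_cases s
    · exact (mul_eq_zero.1 h0).resolve_right hpos
    · exact (mul_eq_zero.1 h1).resolve_right hpos
  subst hc0
  refine Prod.ext (funext fun i => Subtype.ext ?_) rfl
  simpa using hcomp i

/-- Injectivity bounds the dimension of the space by the number of functionals, and `assembleField`
bounds it from below by the same number, so injectivity implies surjectivity. -/
theorem conj_two (e : Basis (Fin 2) ℝ (Space 2)) {k : ℕ} (hk : 1 ≤ k) : Conj k 2 e := by
  intro T
  let M := momentMap k T T.facet_two_ne_top e
  have hinj : Function.Injective M := by
    rw [injective_iff_map_eq_zero]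
    intro v hv
    exact Subtype.ext ((VanishingMoments.of_moment_eq_zero (e := e)
      fun ι => congrFun hv ι).eq_zero hk v.2)
  have : Module.Finite ℝ (fieldSpace k 2) := Module.Finite.of_injective M hinj
  have : Fintype (InteriorIndex k 2) := Fintype.ofFinite _
  have : Fintype (FacetIndex k 2) := Fintype.ofFinite _
  have hle := LinearMap.finrank_le_finrank_of_injective hinj
  have hge := LinearMap.finrank_le_finrank_of_injective
    (f := (assembleField k).codRestrict (fieldSpace k 2) (assembleField_mem k))
    ((LinearMap.injective_codRestrict_iff _).2 (assembleField_injective k))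
  have h1 := card_interiorIndex_le k
  have h2 := card_facetIndex_le k
  have h3 := le_finrank_restrictTotalDegree k
  have hcard : finrank ℝ (InteriorIndex k 2 ⊕ FacetIndex k 2 → ℝ) =
      Nat.card (InteriorIndex k 2) + Nat.card (FacetIndex k 2) := by
    rw [finrank_fintype_fun_eq_card, Fintype.card_sum, Nat.card_eq_fintype_card,
      Nat.card_eq_fintype_card]
  have hdom : finrank ℝ ((Fin 2 → MvPolynomial.restrictTotalDegree (Fin 2) ℝ k) ×
      (Fin (k - 1) × Fin 2 → ℝ)) =
      2 * finrank ℝ (MvPolynomial.restrictTotalDegree (Fin 2) ℝ k) + (k - 1) * 2 := by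
    rw [finrank_prod, finrank_pi_fintype, finrank_fintype_fun_eq_card]
    simp
  -- With `t(n) = 1 + ⋯ + n`, the identity is `2 t(k+1) + 2(k-1) = 2 t(k-1) + 6k`; peeling off two
  -- summands makes it linear.
  have heq : finrank ℝ (fieldSpace k 2) =
      finrank ℝ (InteriorIndex k 2 ⊕ FacetIndex k 2 → ℝ) := by
    obtain ⟨n, rfl⟩ := Nat.exists_eq_add_of_le' hk
    rw [Finset.sum_range_succ, Finset.sum_range_succ] at h3
    simp only [Nat.add_sub_cancel] at *
    omega
  exact ⟨hinj, (LinearMap.injective_iff_surjective_of_finrank_eq_finrank heq).1 hinj⟩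

end NonconformingFE

/-! ### The counterexample polynomial: symmetry, harmonicity, degree. -/

namespace NonconformingFE
open Module Measure
open MvPolynomial (X C eval pderiv)

section CounterPoly

/-- The part of degree at most three of the counterexample polynomial. -/
noncomputable def counterPolyLow : MvPolynomial (Fin 3) ℝ :=
  3 * X 0 + 10 * X 0 ^ 3 + 3 * X 1 - 18 * X 0 * X 1 - 15 * X 0 ^ 2 * X 1 - 15 * X 0 * X 1 ^ 2
    + 10 * X 1 ^ 3 + 3 * X 2 - 18 * X 0 * X 2 - 15 * X 0 ^ 2 * X 2 - 18 * X 1 * X 2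
    + 240 * X 0 * X 1 * X 2 - 15 * X 1 ^ 2 * X 2 - 15 * X 0 * X 2 ^ 2 - 15 * X 1 * X 2 ^ 2
    + 10 * X 2 ^ 3

/-- The homogeneous part of degree four of the counterexample polynomial. -/
noncomputable def counterPolyTop : MvPolynomial (Fin 3) ℝ :=
  30 * X 0 ^ 3 * X 1 - 15 * X 0 ^ 4 + 45 * X 0 ^ 2 * X 1 ^ 2 + 30 * X 0 * X 1 ^ 3
    - 15 * X 1 ^ 4 + 30 * X 0 ^ 3 * X 2 - 180 * X 0 ^ 2 * X 1 * X 2 - 180 * X 0 * X 1 ^ 2 * X 2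
    + 30 * X 1 ^ 3 * X 2 + 45 * X 0 ^ 2 * X 2 ^ 2 - 180 * X 0 * X 1 * X 2 ^ 2
    + 45 * X 1 ^ 2 * X 2 ^ 2 + 30 * X 0 * X 2 ^ 3 + 30 * X 1 * X 2 ^ 3 - 15 * X 2 ^ 4

theorem counterPoly_eq : counterPoly = counterPolyLow + counterPolyTop := by
  simp only [counterPoly, counterPolyLow, counterPolyTop]
  ring

theorem pderiv_ofNat (i : Fin 3) (n : ℕ) [n.AtLeastTwo] :
    pderiv i (ofNat(n) : MvPolynomial (Fin 3) ℝ) = 0 := by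
  have h : (OfNat.ofNat n : MvPolynomial (Fin 3) ℝ) = ((n : ℕ) : MvPolynomial (Fin 3) ℝ) := rfl
  rw [h]
  exact Derivation.map_natCast _ _

/-- The component of the gradient of the counterexample polynomial in the direction of its first
argument; it is symmetric in the other two. -/
def counterComponent {R : Type*} [CommRing R] (a b c : R) : R :=
  3 + 30 * a ^ 2 - 60 * a ^ 3 - 18 * b - 30 * a * b + 90 * a ^ 2 * b - 15 * b ^ 2
    + 90 * a * b ^ 2 + 30 * b ^ 3 - 18 * c - 30 * a * c + 90 * a ^ 2 * c + 240 * b * c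
    - 360 * a * b * c - 180 * b ^ 2 * c - 15 * c ^ 2 + 90 * a * c ^ 2 - 180 * b * c ^ 2
    + 30 * c ^ 3

/-- Invariance under all permutations of the variables reduces every later computation to one
partial derivative. -/
theorem counterPoly_symmetric {m m' m'' : Fin 3} (h : m ≠ m') (h' : m ≠ m'') (h'' : m' ≠ m'') :
    counterPoly =
      3 * X m + 10 * X m ^ 3 + 3 * X m' - 18 * X m * X m' - 15 * X m ^ 2 * X m'
      - 15 * X m * X m' ^ 2 + 10 * X m' ^ 3 + 3 * X m'' - 18 * X m * X m'' - 15 * X m ^ 2 * X m''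
      - 18 * X m' * X m'' + 240 * X m * X m' * X m'' - 15 * X m' ^ 2 * X m''
      - 15 * X m * X m'' ^ 2 - 15 * X m' * X m'' ^ 2 + 10 * X m'' ^ 3 +
      30 * X m ^ 3 * X m' - 15 * X m ^ 4 + 45 * X m ^ 2 * X m' ^ 2 + 30 * X m * X m' ^ 3
      - 15 * X m' ^ 4 + 30 * X m ^ 3 * X m'' - 180 * X m ^ 2 * X m' * X m''
      - 180 * X m * X m' ^ 2 * X m'' + 30 * X m' ^ 3 * X m'' + 45 * X m ^ 2 * X m'' ^ 2
      - 180 * X m * X m' * X m'' ^ 2 + 45 * X m' ^ 2 * X m'' ^ 2 + 30 * X m * X m'' ^ 3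
      + 30 * X m' * X m'' ^ 3 - 15 * X m'' ^ 4 := by
  fin_cases m <;> fin_cases m' <;> fin_cases m'' <;>
    first
    | exact absurd rfl h
    | exact absurd rfl h'
    | exact absurd rfl h''
    | (simp only [Fin.zero_eta, Fin.mk_one, Fin.reduceFinMk, counterPoly]
       ring)

theorem pderiv_counterPoly {m m' m'' : Fin 3} (h : m ≠ m') (h' : m ≠ m'') (h'' : m' ≠ m'') :
    pderiv m counterPoly = counterComponent (X m) (X m') (X m'') := by
  rw [counterPoly_symmetric h h' h'']
  simp only [counterComponent, map_add, map_sub, Derivation.leibniz, Derivation.leibniz_pow,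
    pderiv_ofNat, MvPolynomial.pderiv_X_self, MvPolynomial.pderiv_X_of_ne h.symm,
    MvPolynomial.pderiv_X_of_ne h'.symm, smul_eq_mul, mul_zero, add_zero, zero_add, mul_one,
    smul_zero, nsmul_eq_mul, Nat.reduceSub, pow_one, Nat.cast_ofNat]
  ring

theorem laplacian_counterPolyTop : laplacian 3 counterPolyTop = 0 := by
  rw [laplacian_apply, Fin.sum_univ_three]
  simp only [counterPolyTop,
    map_add, map_sub, Derivation.leibniz, Derivation.leibniz_pow, pderiv_ofNat,
    MvPolynomial.pderiv_X_self, ne_eq, Fin.reduceEq, not_false_eq_true, zero_ne_one, one_ne_zero,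
    MvPolynomial.pderiv_X_of_ne, smul_eq_mul, mul_zero, add_zero, zero_add, mul_one,
    smul_zero, nsmul_eq_mul, Nat.reduceSub, pow_one, Nat.cast_ofNat, sub_zero]
  ring

theorem laplacian_counterPolyLow : laplacian 3 counterPolyLow = 0 := by
  rw [laplacian_apply, Fin.sum_univ_three]
  simp only [counterPolyLow,
    map_add, map_sub, Derivation.leibniz, Derivation.leibniz_pow, pderiv_ofNat,
    MvPolynomial.pderiv_X_self, ne_eq, Fin.reduceEq, not_false_eq_true, zero_ne_one, one_ne_zero,
    MvPolynomial.pderiv_X_of_ne, smul_eq_mul, mul_zero, add_zero, zero_add, mul_one,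
    smul_zero, nsmul_eq_mul, Nat.reduceSub, pow_one, Nat.cast_ofNat, sub_zero, zero_sub]
  ring

theorem laplacian_counterPoly : laplacian 3 counterPoly = 0 := by
  rw [counterPoly_eq, map_add, laplacian_counterPolyLow, laplacian_counterPolyTop, add_zero]

theorem ofNat_mul_eq_smul (n : ℕ) [n.AtLeastTwo] (f : MvPolynomial (Fin 3) ℝ) :
    (ofNat(n) : MvPolynomial (Fin 3) ℝ) * f = (n : ℝ) • f := by
  have h : (OfNat.ofNat n : MvPolynomial (Fin 3) ℝ) = ((n : ℕ) : MvPolynomial (Fin 3) ℝ) := rfl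
  rw [h, Nat.cast_smul_eq_nsmul, nsmul_eq_mul]

theorem isHomogeneous_counterPolyTop : counterPolyTop.IsHomogeneous 4 := by
  have hX : ∀ (i : Fin 3) (n : ℕ), (X i ^ n : MvPolynomial (Fin 3) ℝ).IsHomogeneous n :=
    fun i n => MvPolynomial.isHomogeneous_X_pow i n
  have hX1 : ∀ (i : Fin 3), (X i : MvPolynomial (Fin 3) ℝ).IsHomogeneous 1 :=
    MvPolynomial.isHomogeneous_X ℝ
  have h1 : ∀ i, (X i ^ 4 : MvPolynomial (Fin 3) ℝ).IsHomogeneous 4 := fun i => hX i 4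
  have h2 : ∀ i j, (X i ^ 3 * X j : MvPolynomial (Fin 3) ℝ).IsHomogeneous 4 := fun i j =>
    (hX i 3).mul (hX1 j)
  have h3 : ∀ i j, (X i * X j ^ 3 : MvPolynomial (Fin 3) ℝ).IsHomogeneous 4 := fun i j =>
    (hX1 i).mul (hX j 3)
  have h4 : ∀ i j, (X i ^ 2 * X j ^ 2 : MvPolynomial (Fin 3) ℝ).IsHomogeneous 4 := fun i j =>
    (hX i 2).mul (hX j 2)
  have h5 : ∀ i j k, (X i ^ 2 * (X j * X k) : MvPolynomial (Fin 3) ℝ).IsHomogeneous 4 :=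
    fun i j k => (hX i 2).mul ((hX1 j).mul (hX1 k))
  have h6 : ∀ i j k, (X i * (X j ^ 2 * X k) : MvPolynomial (Fin 3) ℝ).IsHomogeneous 4 :=
    fun i j k => (hX1 i).mul ((hX j 2).mul (hX1 k))
  have h7 : ∀ i j k, (X i * (X j * X k ^ 2) : MvPolynomial (Fin 3) ℝ).IsHomogeneous 4 :=
    fun i j k => (hX1 i).mul ((hX1 j).mul (hX k 2))
  rw [← MvPolynomial.mem_homogeneousSubmodule]
  simp only [counterPolyTop, mul_assoc]
  simp only [ofNat_mul_eq_smul]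
  repeat' first
    | apply Submodule.add_mem
    | apply Submodule.sub_mem
    | apply Submodule.smul_mem
  all_goals simp only [MvPolynomial.mem_homogeneousSubmodule, h1, h2, h3, h4, h5, h6, h7]

theorem totalDegree_counterPolyLow_le : counterPolyLow.totalDegree ≤ 3 := by
  have hX1 : ∀ (i : Fin 3), (X i : MvPolynomial (Fin 3) ℝ).totalDegree ≤ 1 := fun i =>
    (MvPolynomial.totalDegree_X i).le
  have hmul : ∀ {a b : ℕ} {f g : MvPolynomial (Fin 3) ℝ}, f.totalDegree ≤ a → g.totalDegree ≤ b →
      (f * g).totalDegree ≤ a + b := fun hf hg =>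
    (MvPolynomial.totalDegree_mul _ _).trans (Nat.add_le_add hf hg)
  have hX : ∀ (i : Fin 3) (n : ℕ), (X i ^ n : MvPolynomial (Fin 3) ℝ).totalDegree ≤ n :=
    fun i n => (MvPolynomial.totalDegree_X_pow i n).le
  have h1 : ∀ i, (X i ^ 3 : MvPolynomial (Fin 3) ℝ).totalDegree ≤ 3 := fun i => hX i 3
  have h2 : ∀ i, (X i : MvPolynomial (Fin 3) ℝ).totalDegree ≤ 3 := fun i =>
    (hX1 i).trans (by norm_num)
  have h3 : ∀ i j, (X i * X j : MvPolynomial (Fin 3) ℝ).totalDegree ≤ 3 := fun i j =>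
    (hmul (hX1 i) (hX1 j)).trans (by norm_num)
  have h4 : ∀ i j, (X i ^ 2 * X j : MvPolynomial (Fin 3) ℝ).totalDegree ≤ 3 := fun i j =>
    hmul (hX i 2) (hX1 j)
  have h5 : ∀ i j, (X i * X j ^ 2 : MvPolynomial (Fin 3) ℝ).totalDegree ≤ 3 := fun i j =>
    hmul (hX1 i) (hX j 2)
  have h6 : ∀ i j k, (X i * (X j * X k) : MvPolynomial (Fin 3) ℝ).totalDegree ≤ 3 := fun i j k =>
    hmul (hX1 i) (hmul (hX1 j) (hX1 k))
  rw [← MvPolynomial.mem_restrictTotalDegree]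
  simp only [counterPolyLow, mul_assoc]
  simp only [ofNat_mul_eq_smul]
  repeat' first
    | apply Submodule.add_mem
    | apply Submodule.sub_mem
    | apply Submodule.smul_mem
  all_goals simp only [MvPolynomial.mem_restrictTotalDegree, h1, h2, h3, h4, h5, h6]

theorem totalDegree_counterPoly : counterPoly.totalDegree = 4 := by
  refine le_antisymm ?_ ?_
  · rw [counterPoly_eq]
    exact (MvPolynomial.totalDegree_add _ _).trans (max_le
      (totalDegree_counterPolyLow_le.trans (by norm_num)) isHomogeneous_counterPolyTop.totalDegree_le)
  -- Restriction to the first coordinate axis leaves a univariate polynomial of degree four, which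
  -- bounds the total degree from below.
  · have h := MvPolynomial.aeval_natDegree_le counterPoly le_rfl
      (![Polynomial.X, 0, 0] : Fin 3 → Polynomial ℝ) (n := 1)
      (fun i => by fin_cases i <;> simp)
    have h2 : MvPolynomial.aeval (![Polynomial.X, 0, 0] : Fin 3 → Polynomial ℝ) counterPoly =
        3 * Polynomial.X + 10 * Polynomial.X ^ 3 - 15 * Polynomial.X ^ 4 := by
      simp [counterPoly]
    have h3 : (3 * Polynomial.X + 10 * Polynomial.X ^ 3 - 15 * Polynomial.X ^ 4 :
        Polynomial ℝ).natDegree = 4 := by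
      compute_degree!
    rw [h2, h3, mul_one] at h
    exact h

theorem polyGradient_counterPoly_mem : polyGradient 3 counterPoly ∈ fieldSpace 2 3 := by
  rw [counterPoly_eq, map_add]
  refine Submodule.add_mem_sup (fun i _ => ?_) ?_
  · exact (MvPolynomial.mem_restrictTotalDegree _ _ _).2
      (totalDegree_pderiv_le i totalDegree_counterPolyLow_le)
  · have h4 : 4 ∈ Finset.Icc (2 + 2) (2 * 2) := by decide
    exact le_iSup₂_of_le (f := fun m (_ : m ∈ Finset.Icc (2 + 2) (2 * 2)) =>
      (harmonicHomogeneous 3 m).map (polyGradient 3)) 4 h4 le_rfl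
      (Submodule.mem_map_of_mem ⟨isHomogeneous_counterPolyTop, laplacian_counterPolyTop⟩)

theorem polyGradient_counterPoly_ne_zero : polyGradient 3 counterPoly ≠ 0 := by
  intro h
  have h1 := congrArg (eval fun _ => (1 : ℝ)) (congrFun h 0)
  rw [polyGradient_apply, pderiv_counterPoly (m' := 1) (m'' := 2) (by decide) (by decide)
    (by decide)] at h1
  norm_num [counterComponent] at h1

end CounterPoly

end NonconformingFE

/-! ### Explicit integrals over the reference simplices. -/

namespace NonconformingFE
open Module Measure
open MvPolynomial (X C eval pderiv)

section Quadrature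

open Simplex

theorem integral_quintic (L h0 h1 h2 h3 h4 h5 : ℝ) :
    ∫ t in (0 : ℝ)..L, (h0 + h1 * t + h2 * t ^ 2 + h3 * t ^ 3 + h4 * t ^ 4 + h5 * t ^ 5) =
      h0 * L + h1 * L ^ 2 / 2 + h2 * L ^ 3 / 3 + h3 * L ^ 4 / 4 + h4 * L ^ 5 / 5
        + h5 * L ^ 6 / 6 := by
  have hderiv : ∀ t : ℝ, HasDerivAt (fun t : ℝ => h0 * t + h1 * t ^ 2 / 2 + h2 * t ^ 3 / 3
      + h3 * t ^ 4 / 4 + h4 * t ^ 5 / 5 + h5 * t ^ 6 / 6)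
      (h0 + h1 * t + h2 * t ^ 2 + h3 * t ^ 3 + h4 * t ^ 4 + h5 * t ^ 5) t := by
    intro t
    have hp : ∀ (c : ℝ) (n : ℕ), HasDerivAt (fun t : ℝ => c * t ^ n) (c * (n * t ^ (n - 1))) t :=
      fun c n => (hasDerivAt_pow n t).const_mul c
    have := ((((((hasDerivAt_id t).const_mul h0).add ((hp h1 2).div_const 2)).add
      ((hp h2 3).div_const 3)).add ((hp h3 4).div_const 4)).add ((hp h4 5).div_const 5)).add
      ((hp h5 6).div_const 6)
    refine this.congr_deriv ?_
    norm_num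
    ring
  rw [intervalIntegral.integral_eq_sub_of_hasDerivAt (fun t _ => hderiv t)
    (Continuous.intervalIntegrable (by fun_prop) _ _)]
  ring

/-- The coefficients on the right are the moments `a! b! / (a + b + 2)!` of the reference triangle.
-/
theorem integral_refTriangle_quartic
    (c00 c10 c01 c20 c11 c02 c30 c21 c12 c03 c40 c31 c22 c13 c04 : ℝ) :
    ∫ x in refTriangle, (c00 + c10 * x.1 + c01 * x.2 + c20 * x.1 ^ 2 + c11 * x.1 * x.2
      + c02 * x.2 ^ 2 + c30 * x.1 ^ 3 + c21 * x.1 ^ 2 * x.2 + c12 * x.1 * x.2 ^ 2 + c03 * x.2 ^ 3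
      + c40 * x.1 ^ 4 + c31 * x.1 ^ 3 * x.2 + c22 * x.1 ^ 2 * x.2 ^ 2 + c13 * x.1 * x.2 ^ 3
      + c04 * x.2 ^ 4) =
    c00 / 2 + c10 / 6 + c01 / 6 + c20 / 12 + c11 / 24 + c02 / 12 + c30 / 20 + c21 / 60 + c12 / 60
      + c03 / 20 + c40 / 30 + c31 / 120 + c22 / 180 + c13 / 120 + c04 / 30 := by
  rw [setIntegral_refTriangle (by fun_prop)]
  have hinner : ∀ s : ℝ, ∫ t in (0 : ℝ)..1 - s, (c00 + c10 * s + c01 * t + c20 * s ^ 2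
      + c11 * s * t + c02 * t ^ 2 + c30 * s ^ 3 + c21 * s ^ 2 * t + c12 * s * t ^ 2 + c03 * t ^ 3
      + c40 * s ^ 4 + c31 * s ^ 3 * t + c22 * s ^ 2 * t ^ 2 + c13 * s * t ^ 3 + c04 * t ^ 4) =
      (c00 + c01 / 2 + c02 / 3 + c03 / 4 + c04 / 5)
      + (-c00 + c10 - c01 + c11 / 2 - c02 + c12 / 3 - c03 + c13 / 4 - c04) * s
      + (-c10 + c01 / 2 + c20 - c11 + c02 + c21 / 2 - c12 + c03 * (3 / 2) + c22 / 3 - c13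
        + c04 * 2) * s ^ 2
      + (-c20 + c11 / 2 - c02 / 3 + c30 - c21 + c12 - c03 + c31 / 2 - c22 + c13 * (3 / 2)
        - c04 * 2) * s ^ 3
      + (-c30 + c21 / 2 - c12 / 3 + c03 / 4 + c40 - c31 + c22 - c13 + c04) * s ^ 4
      + (-c40 + c31 / 2 - c22 / 3 + c13 / 4 - c04 / 5) * s ^ 5 := by
    intro s
    have h := integral_quintic (1 - s) (c00 + c10 * s + c20 * s ^ 2 + c30 * s ^ 3 + c40 * s ^ 4)
      (c01 + c11 * s + c21 * s ^ 2 + c31 * s ^ 3) (c02 + c12 * s + c22 * s ^ 2)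
      (c03 + c13 * s) c04 0
    refine (intervalIntegral.integral_congr fun t _ => ?_).trans (h.trans ?_)
    · ring
    · ring
  simp only [hinner]
  rw [integral_quintic]
  ring

/-- The first factor is the general affine function, with values `A`, `B`, `D` at the vertices: for
`k = 2` the face weights are linear. -/
theorem integral_refTriangle_weight_mul_cubic
    (A B D c00 c10 c01 c20 c11 c02 c30 c21 c12 c03 : ℝ) :
    ∫ x in refTriangle, (A * (1 - x.1 - x.2) + B * x.1 + D * x.2) *
      (c00 + c10 * x.1 + c01 * x.2 + c20 * x.1 ^ 2 + c11 * x.1 * x.2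
      + c02 * x.2 ^ 2 + c30 * x.1 ^ 3 + c21 * x.1 ^ 2 * x.2 + c12 * x.1 * x.2 ^ 2
      + c03 * x.2 ^ 3) =
    A * (c00 / 6 + c10 / 24 + c01 / 24 + c20 / 60 + c11 / 120 + c02 / 60 + c30 / 120 + c21 / 360
      + c12 / 360 + c03 / 120) +
    B * (c00 / 6 + c10 / 12 + c01 / 24 + c20 / 20 + c11 / 60 + c02 / 60 + c30 / 30 + c21 / 120
      + c12 / 180 + c03 / 120) +
    D * (c00 / 6 + c10 / 24 + c01 / 12 + c20 / 60 + c11 / 60 + c02 / 20 + c30 / 120 + c21 / 180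
      + c12 / 120 + c03 / 30) := by
  have h := integral_refTriangle_quartic (A * c00) (A * (c10 - c00) + B * c00)
    (A * (c01 - c00) + D * c00) (A * (c20 - c10) + B * c10)
    (A * (c11 - c10 - c01) + B * c01 + D * c10) (A * (c02 - c01) + D * c01)
    (A * (c30 - c20) + B * c20) (A * (c21 - c20 - c11) + B * c11 + D * c20)
    (A * (c12 - c11 - c02) + B * c02 + D * c11) (A * (c03 - c02) + D * c02)
    (-(A * c30) + B * c30) (-(A * (c30 + c21)) + B * c21 + D * c30)
    (-(A * (c21 + c12)) + B * c12 + D * c21) (-(A * (c12 + c03)) + B * c03 + D * c12)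
    (-(A * c03) + D * c03)
  refine Eq.trans (integral_congr_ae (.of_forall fun x => ?_)) (h.trans ?_)
  · simp only; ring
  · ring

/-- The coordinate face on which the variable of differentiation is zero. The next two lemmas treat
a coordinate face containing that direction and the slanted face. -/
theorem integral_counterComponent_off (A B D : ℝ) :
    ∫ x in refTriangle, (A * (1 - x.1 - x.2) + B * x.1 + D * x.2) *
      counterComponent 0 x.1 x.2 = 0 := by
  have h := integral_refTriangle_weight_mul_cubic A B D 3 (-18) (-18) (-15) 240 (-15) 30 (-180)
    (-180) 30
  refine Eq.trans (integral_congr_ae (.of_forall fun x => ?_)) (h.trans ?_)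
  · simp only [counterComponent]; ring
  · ring

theorem integral_counterComponent_on (A B D : ℝ) :
    ∫ x in refTriangle, (A * (1 - x.1 - x.2) + B * x.1 + D * x.2) *
      counterComponent x.1 0 x.2 = 0 := by
  have h := integral_refTriangle_weight_mul_cubic A B D 3 0 (-18) 30 (-30) (-15) (-60) 90 90 30
  refine Eq.trans (integral_congr_ae (.of_forall fun x => ?_)) (h.trans ?_)
  · simp only [counterComponent]; ring
  · ring

theorem integral_counterComponent_slant (A B D : ℝ) :
    ∫ x in refTriangle, (A * (1 - x.1 - x.2) + B * x.1 + D * x.2) *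
      counterComponent (1 - x.1 - x.2) x.1 x.2 = 0 := by
  have h := integral_refTriangle_weight_mul_cubic A B D (-27) 162 162 (-225) (-720) (-225) 90 540
    540 90
  refine Eq.trans (integral_congr_ae (.of_forall fun x => ?_)) (h.trans ?_)
  · simp only [counterComponent]; ring
  · ring

theorem integral_counterComponent_refTetrahedron :
    ∫ x in refTetrahedron, counterComponent x.2 x.1.1 x.1.2 = 0 := by
  rw [setIntegral_refTetrahedron (by unfold counterComponent; fun_prop)]
  have hinner : ∀ x : ℝ × ℝ, ∫ t in (0 : ℝ)..1 - x.1 - x.2, counterComponent t x.1 x.2 =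
      -2 + 24 * x.1 + 24 * x.2 + -72 * x.1 ^ 2 + -144 * x.1 * x.2
      + -72 * x.2 ^ 2 + 80 * x.1 ^ 3 + 240 * x.1 ^ 2 * x.2 + 240 * x.1 * x.2 ^ 2 + 80 * x.2 ^ 3
      + -30 * x.1 ^ 4 + -120 * x.1 ^ 3 * x.2 + -180 * x.1 ^ 2 * x.2 ^ 2 + -120 * x.1 * x.2 ^ 3
      + -30 * x.2 ^ 4 := by
    rintro ⟨b, c⟩
    have h := integral_quintic (1 - b - c)
      (3 - 18 * b - 15 * b ^ 2 + 30 * b ^ 3 - 18 * c + 240 * b * c - 180 * b ^ 2 * c - 15 * c ^ 2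
        - 180 * b * c ^ 2 + 30 * c ^ 3)
      (- 30 * b + 90 * b ^ 2 - 30 * c - 360 * b * c + 90 * c ^ 2)
      (30 + 90 * b + 90 * c) (-60) 0 0
    refine (intervalIntegral.integral_congr fun t _ => ?_).trans (h.trans ?_)
    · simp only [counterComponent]; ring
    · ring
  simp only [hinner]
  rw [integral_refTriangle_quartic]
  norm_num

end Quadrature

/-! ### The functionals vanish on the gradient in dimension three. -/

section Counterexample

theorem unitTetrahedron_zero (i : Fin 3) : unitTetrahedron 0 i = 0 := rfl

theorem unitTetrahedron_succ (l i : Fin 3) :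
    unitTetrahedron l.succ i = if i = l then 1 else 0 := by
  change (Fin.cons 0 (fun i : Fin 3 => EuclideanSpace.single i (1 : ℝ)) : Fin 4 → Space 3)
    l.succ i = _
  rw [Fin.cons_succ]
  simp

theorem eval_pderiv_counterPoly {m m' m'' : Fin 3} (h : m ≠ m') (h' : m ≠ m'') (h'' : m' ≠ m'')
    (x : Space 3) : eval (fun j => x j) (pderiv m counterPoly) =
      counterComponent (x m) (x m') (x m'') := by
  rw [pderiv_counterPoly h h' h'']
  simp only [counterComponent, map_add, map_sub, map_mul, map_pow, MvPolynomial.eval_X, map_ofNat]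

theorem baryMonomial_of_sum_eq_zero {d : ℕ} (T : Simplex d) {α : Fin (d + 1) → ℕ}
    (h : ∑ l, α l = 0) (x : Space d) : T.baryMonomial α x = 1 := by
  have : ∀ l, α l = 0 := fun l => (Finset.sum_eq_zero_iff.1 h) l (Finset.mem_univ l)
  simp [Simplex.baryMonomial, this]

theorem exists_baryMonomial_eq_coord {d : ℕ} (T : Simplex d) {β : Fin (d + 1) → ℕ}
    (h : ∑ l, β l = 1) : ∃ l, ∀ x, T.baryMonomial β x = T.coord l x := by
  classical
  obtain ⟨l, hl⟩ : ∃ l, β l ≠ 0 := by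
    by_contra! hcon
    simp [hcon] at h
  have hsum := Finset.add_sum_erase Finset.univ β (Finset.mem_univ l)
  have hl1 : β l = 1 := by omega
  have hrest : ∀ i, i ≠ l → β i = 0 := fun i hi =>
    Finset.sum_eq_zero_iff.1 (show ∑ i ∈ Finset.univ.erase l, β i = 0 by omega) i
      (Finset.mem_erase.2 ⟨hi, Finset.mem_univ i⟩)
  refine ⟨l, fun x => ?_⟩
  rw [Simplex.baryMonomial, Finset.prod_eq_single l]
  · rw [hl1, pow_one]
  · exact fun i _ hi => by rw [hrest i hi, pow_zero]
  · exact fun hcon => absurd (Finset.mem_univ l) hcon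

theorem exists_baryMonomial_triMap {d : ℕ} (T : Simplex d) {β : Fin (d + 1) → ℕ}
    (h : ∑ l, β l = 1) (p q r : Fin (d + 1)) : ∃ A B D : ℝ, ∀ x : ℝ × ℝ,
      T.baryMonomial β (T.triMap p q r x) = A * (1 - x.1 - x.2) + B * x.1 + D * x.2 := by
  obtain ⟨l, hl⟩ := exists_baryMonomial_eq_coord T h
  refine ⟨T.coord l (T p), T.coord l (T q), T.coord l (T r), fun x => ?_⟩
  rw [hl, Simplex.coord_triMap]
  ring

theorem integral_body_pderiv_counterPoly (m : Fin 3) :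
    ∫ x in unitTetrahedron.body, eval (fun j => x j) (pderiv m counterPoly) = 0 := by
  obtain ⟨m', m'', h, h', h''⟩ : ∃ m' m'' : Fin 3, m ≠ m' ∧ m ≠ m'' ∧ m' ≠ m'' := by
    decide +revert
  have hs : ∀ {a b : Fin 3}, a ≠ b → a.succ ≠ b.succ := fun hab => (Fin.succ_injective 3).ne hab
  obtain ⟨c, hI⟩ := unitTetrahedron.exists_integral_body_three (Fin.succ_ne_zero m').symm
    (Fin.succ_ne_zero m'').symm (hs h'') (Fin.succ_ne_zero m).symm (hs h.symm) (hs h'.symm)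
  rw [hI]
  simp only [eval_pderiv_counterPoly h h' h'']
  simp only [Simplex.tetMap_apply, PiLp.add_apply,
    PiLp.smul_apply, PiLp.sub_apply, unitTetrahedron_zero, unitTetrahedron_succ, smul_eq_mul,
    h, h', h'', h.symm, h'.symm, h''.symm, if_true, if_false, sub_zero, mul_one, mul_zero,
    add_zero, zero_add]
  rw [integral_counterComponent_refTetrahedron, mul_zero]

theorem integral_facet_pderiv_counterPoly (m : Fin 3) (j : Fin 4) {β : Fin 4 → ℕ}
    (hβ : ∑ l, β l = 1) :
    ∫ x in unitTetrahedron.facet j, unitTetrahedron.baryMonomial β x *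
      eval (fun j => x j) (pderiv m counterPoly) ∂μHE[2] = 0 := by
  -- Facet `0` is the slanted face and facet `a.succ` is the coordinate face `x_a = 0`. Naming the
  -- two remaining variables suitably leaves only three cases.
  obtain ⟨m', m'', h, h', h'', hj⟩ : ∃ m' m'' : Fin 3, m ≠ m' ∧ m ≠ m'' ∧ m' ≠ m'' ∧
      (j = 0 ∨ j = m.succ ∨ j = m'.succ) := by
    decide +revert
  have hs : ∀ {a b : Fin 3}, a ≠ b → a.succ ≠ b.succ := fun hab => (Fin.succ_injective 3).ne hab
  have h0 : ∀ a : Fin 3, (0 : Fin 4) ≠ a.succ := fun a => (Fin.succ_ne_zero a).symm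
  rcases hj with rfl | rfl | rfl
  · obtain ⟨c, hI⟩ := unitTetrahedron.exists_integral_facet_three (hs h) (hs h') (hs h'')
      (h0 m).symm (h0 m').symm (h0 m'').symm
    obtain ⟨A, B, D, hw⟩ := exists_baryMonomial_triMap unitTetrahedron hβ m.succ m'.succ m''.succ
    rw [hI]
    simp only [hw]
    simp only [eval_pderiv_counterPoly h h' h'']
    simp only [Simplex.triMap_apply, PiLp.add_apply,
      PiLp.smul_apply, PiLp.sub_apply, unitTetrahedron_succ, smul_eq_mul,
      h, h', h'', h.symm, h'.symm, h''.symm, if_true, if_false, sub_zero, sub_self, mul_one,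
      mul_zero, add_zero, zero_add, zero_sub, mul_neg, ← sub_eq_add_neg]
    rw [integral_counterComponent_slant, mul_zero]
  · obtain ⟨c, hI⟩ := unitTetrahedron.exists_integral_facet_three (h0 m') (h0 m'') (hs h'')
      (h0 m) (hs h.symm) (hs h'.symm)
    obtain ⟨A, B, D, hw⟩ := exists_baryMonomial_triMap unitTetrahedron hβ 0 m'.succ m''.succ
    rw [hI]
    simp only [hw]
    simp only [eval_pderiv_counterPoly h h' h'']
    simp only [Simplex.triMap_apply, PiLp.add_apply,
      PiLp.smul_apply, PiLp.sub_apply, unitTetrahedron_zero, unitTetrahedron_succ, smul_eq_mul,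
      h, h', h'', h''.symm, if_true, if_false, sub_zero, mul_one, mul_zero,
      add_zero, zero_add]
    rw [integral_counterComponent_off, mul_zero]
  · obtain ⟨c, hI⟩ := unitTetrahedron.exists_integral_facet_three (h0 m) (h0 m'') (hs h')
      (h0 m') (hs h) (hs h''.symm)
    obtain ⟨A, B, D, hw⟩ := exists_baryMonomial_triMap unitTetrahedron hβ 0 m.succ m''.succ
    rw [hI]
    simp only [hw]
    simp only [eval_pderiv_counterPoly h h' h'']
    simp only [Simplex.triMap_apply, PiLp.add_apply,
      PiLp.smul_apply, PiLp.sub_apply, unitTetrahedron_zero, unitTetrahedron_succ, smul_eq_mul,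
      h', h'', h.symm, h'.symm, if_true, if_false, sub_zero, mul_one, mul_zero,
      add_zero, zero_add]
    rw [integral_counterComponent_on, mul_zero]

theorem moment_counterPoly (e : Basis (Fin 3) ℝ (Space 3))
    (ι : InteriorIndex 2 3 ⊕ FacetIndex 2 3) :
    moment unitTetrahedron e ι (polyGradient 3 counterPoly) = 0 := by
  rcases ι with ⟨i, α, hα⟩ | ⟨i, j, β, hβ, hβj⟩
  · refine (integral_mul_inner_value_eq_zero_iff unitTetrahedron.isCompact_body
      unitTetrahedron.isCompact_body.measure_lt_top.ne
      (unitTetrahedron.continuous_baryMonomial α) _ e).2 (fun m => ?_) i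
    simp only [baryMonomial_of_sum_eq_zero unitTetrahedron
      (show ∑ l, α l = 0 by omega), one_mul]
    exact integral_body_pderiv_counterPoly m
  · exact (integral_mul_inner_value_eq_zero_iff (unitTetrahedron.isCompact_facet j)
      (unitTetrahedron.facet_three_ne_top j)
      (unitTetrahedron.continuous_baryMonomial β) _ e).2
      (fun m => integral_facet_pderiv_counterPoly m j (show ∑ l, β l = 1 by omega)) i

/-- Uniqueness fails: the gradient and the zero field have the same moments. -/
theorem not_conj_two_three (e : Basis (Fin 3) ℝ (Space 3)) : ¬ Conj 2 3 e := by
  intro h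
  have h0 : ∀ ι : InteriorIndex 2 3 ⊕ FacetIndex 2 3, moment unitTetrahedron e ι 0 = 0 := fun ι =>
    (isLinearMap_moment unitTetrahedron unitTetrahedron.facet_three_ne_top e ι).map_zero
  have := @(h unitTetrahedron).1 ⟨_, polyGradient_counterPoly_mem⟩ 0
    (funext fun ι => (moment_counterPoly e ι).trans (h0 ι).symm)
  exact polyGradient_counterPoly_ne_zero (congrArg Subtype.val this)

end Counterexample

end NonconformingFE

theorem mainTheorem1 :
    -- unisolvence in dimension two, for every order
    (∀ (e : Module.Basis (Fin 2) ℝ (NonconformingFE.Space 2)) (k : ℕ), 1 ≤ k →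
      NonconformingFE.Conj k 2 e) ∧
    -- failure in dimension three for quadratic fields
    (∀ e : Module.Basis (Fin 3) ℝ (NonconformingFE.Space 3), ¬ NonconformingFE.Conj 2 3 e) ∧
    -- the explicit field which is annihilated by all functionals
    (NonconformingFE.counterPoly.totalDegree = 4 ∧
      NonconformingFE.laplacian 3 NonconformingFE.counterPoly = 0 ∧
      NonconformingFE.polyGradient 3 NonconformingFE.counterPoly ∈ NonconformingFE.fieldSpace 2 3 ∧
      NonconformingFE.polyGradient 3 NonconformingFE.counterPoly ≠ 0 ∧
      ∀ (e : Module.Basis (Fin 3) ℝ (NonconformingFE.Space 3))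
        (ι : NonconformingFE.InteriorIndex 2 3 ⊕ NonconformingFE.FacetIndex 2 3),
        NonconformingFE.moment NonconformingFE.unitTetrahedron e ι
          (NonconformingFE.polyGradient 3 NonconformingFE.counterPoly) = 0) := by
  exact ⟨fun e k hk => NonconformingFE.conj_two e hk, NonconformingFE.not_conj_two_three,
    NonconformingFE.totalDegree_counterPoly, NonconformingFE.laplacian_counterPoly,
    NonconformingFE.polyGradient_counterPoly_mem, NonconformingFE.polyGradient_counterPoly_ne_zero,
    NonconformingFE.moment_counterPoly⟩
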